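/- Let $M$ be a smooth manifold of dimension $m$, let $\mathcal V$ be an involutive smooth distribution on $M$ of constant dimension $n$ with $2n\le m$, and let $F$ be a smooth vector field on $M$. Let $\mathcal W=\mathcal V+[F,\mathcal V]$ be the collection of vector fields of the form $V+[F,V']$, where $V,V'$ are (local) smooth vector fields belonging to $\mathcal V$; let $\mathcal W_z\subset T_zM$ be the span of their values at $z$, and let $M_0=\{z\in M:\dim\mathcal W_z=2n\}$, so that $\mathcal W$ is a distribution of dimension $2n$ on the open set $M_0$. (On $M_0$ one automatically has $[F,\mathcal V]\cap\mathcal V=\{0\}$, i.e. if $V\in\mathcal V$ and $[F,V]\in\mathcal V$ then $V=0$.) Suppose that $\mathcal W$ is involutive on $M_0$. Then every point of $M_0$ has an open neighbourhood $U$ with smooth local coordinates $(t^p,x^i,y^i)$ of $M$ on $U$, $p=1,\dots,m-2n$, $i=1,\dots,n$, and a basis $V_1,\dots,V_n$ of $\mathcal V$ over $U$ such that, with $W_i=[F,V_i]$, one has $[V_i,V_j]=0$ and $[V_i,W_j]\in\mathcal V$ for all $i,j$, and $$V_i=\frac{\partial}{\partial y^i},\qquad W_i=-\frac{\partial}{\partial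 x^i}\pmod{\mathcal V}\qquad (i=1,\dots,n)$$ on $U$. -/

import Mathlib

open scoped Manifold ContDiff
open VectorField

namespace SecondOrderType

variable {m : ℕ} {M : Type*} [TopologicalSpace M] [ChartedSpace (EuclideanSpace ℝ (Fin m)) M]
  [IsManifold (𝓡 m) ∞ M]

/-- The vector field `X` is smooth on the set `U`. -/
def SmoothFieldOn (X : ∀ z : M, TangentSpace (𝓡 m) z) (U : Set M) : Prop :=
  ContMDiffOn (𝓡 m) (𝓡 m).tangent ∞ (fun z => (⟨z, X z⟩ : TangentBundle (𝓡 m) M)) U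

/-- `X` is a smooth vector field on `U` belonging to the field of tangent subspaces `D`. -/
structure IsSectionOn (D : ∀ z : M, Submodule ℝ (TangentSpace (𝓡 m) z))
    (X : ∀ z : M, TangentSpace (𝓡 m) z) (U : Set M) : Prop where
  smooth : SmoothFieldOn X U
  mem : ∀ z ∈ U, X z ∈ D z

/-- The vector fields `X i` form a smooth basis of `D` over `U`. -/
structure IsFrameOn {ι : Type*} (D : ∀ z : M, Submodule ℝ (TangentSpace (𝓡 m) z))
    (X : ι → ∀ z : M, TangentSpace (𝓡 m) z) (U : Set M) : Prop where
  smooth : ∀ i, SmoothFieldOn (X i) U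
  linearIndependent : ∀ z ∈ U, LinearIndependent ℝ (fun i => X i z)
  span_eq : ∀ z ∈ U, Submodule.span ℝ (Set.range fun i => X i z) = D z

/-- `D` is a smooth distribution of dimension `n`: it admits local smooth bases with `n`
elements around every point. -/
def IsDistribution (n : ℕ) (D : ∀ z : M, Submodule ℝ (TangentSpace (𝓡 m) z)) : Prop :=
  ∀ z : M, ∃ U : Set M, IsOpen U ∧ z ∈ U ∧
    ∃ X : Fin n → ∀ z : M, TangentSpace (𝓡 m) z, IsFrameOn D X U

/-- `D` is involutive over `A`: the Lie bracket of two smooth vector fields belonging to `D`, both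
defined on an open subset of `A`, belongs to `D`. -/
def IsInvolutiveOn (D : ∀ z : M, Submodule ℝ (TangentSpace (𝓡 m) z)) (A : Set M) : Prop :=
  ∀ U : Set M, IsOpen U → U ⊆ A → ∀ X Y : ∀ z : M, TangentSpace (𝓡 m) z,
    IsSectionOn D X U → IsSectionOn D Y U → ∀ z ∈ U, mlieBracket (𝓡 m) X Y z ∈ D z

/-- The subspace of the tangent space at `z` spanned by the values at `z` of the vector fields
`V₁ + [F, V₂]`, where `V₁`, `V₂` are smooth vector fields near `z` that belong to `D`. -/
noncomputable def addBracket (F : ∀ z : M, TangentSpace (𝓡 m) z)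
    (D : ∀ z : M, Submodule ℝ (TangentSpace (𝓡 m) z)) (z : M) :
    Submodule ℝ (TangentSpace (𝓡 m) z) :=
  Submodule.span ℝ {w | ∃ U : Set M, IsOpen U ∧ z ∈ U ∧
    ∃ V₁ V₂ : ∀ z : M, TangentSpace (𝓡 m) z, IsSectionOn D V₁ U ∧ IsSectionOn D V₂ U ∧
      w = V₁ z + mlieBracket (𝓡 m) F V₂ z}

/-- The set of points at which `𝒱 + [F, 𝒱]` has the dimension `2 n`. -/
def regularSet (n : ℕ) (F : ∀ z : M, TangentSpace (𝓡 m) z)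
    (D : ∀ z : M, Submodule ℝ (TangentSpace (𝓡 m) z)) : Set M :=
  {z | Module.finrank ℝ (addBracket F D z) = 2 * n}

variable (m M) in
/-- Smooth local coordinates on `M`, indexed by `ι`: a diffeomorphism of an open subset of `M`
onto an open subset of `ℝ^ι`. -/
structure LocalCoordinates (ι : Type*) [Fintype ι] extends
    OpenPartialHomeomorph M (EuclideanSpace ℝ ι) where
  smooth : ContMDiffOn (𝓡 m) 𝓘(ℝ, EuclideanSpace ℝ ι) ∞ toFun source
  smooth_symm : ContMDiffOn 𝓘(ℝ, EuclideanSpace ℝ ι) (𝓡 m) ∞ invFun target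

/-- The coordinate vector field `∂/∂u^j` of the local coordinates `(u^j)` at a point `z` of the
coordinate domain: the tangent vector that the differential of the coordinate map, which is
invertible there, sends to the `j`-th standard basis vector. -/
noncomputable def LocalCoordinates.coordField {ι : Type*} [Fintype ι] [DecidableEq ι]
    (φ : LocalCoordinates m M ι) (j : ι) (z : M) : TangentSpace (𝓡 m) z :=
  (mfderiv (𝓡 m) 𝓘(ℝ, EuclideanSpace ℝ ι) φ.toFun z).inverse (EuclideanSpace.single j (1 : ℝ))

/-- The index set of coordinates `(t^p, x^i, y^i)` with `p = 1, …, m - 2n` and `i = 1, …, n`. -/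
abbrev CoordIndex (m n : ℕ) : Type := Fin (m - 2 * n) ⊕ (Fin n ⊕ Fin n)

/-- The index of the coordinate `x^i`. -/
abbrev xIndex (m : ℕ) {n : ℕ} (i : Fin n) : CoordIndex m n := Sum.inr (Sum.inl i)

/-- The index of the coordinate `y^i`. -/
abbrev yIndex (m : ℕ) {n : ℕ} (i : Fin n) : CoordIndex m n := Sum.inr (Sum.inr i)

/-- A basis `V₁, …, Vₙ` of `D` over `U` that commutes and, with `W j = [F, V j]`, satisfies
`[V i, W j] ∈ D`. -/
structure IsAdaptedFrameOn {n : ℕ} (F : ∀ z : M, TangentSpace (𝓡 m) z)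
    (D : ∀ z : M, Submodule ℝ (TangentSpace (𝓡 m) z))
    (V : Fin n → ∀ z : M, TangentSpace (𝓡 m) z) (U : Set M) : Prop where
  frame : IsFrameOn D V U
  commute : ∀ i j, ∀ z ∈ U, mlieBracket (𝓡 m) (V i) (V j) z = 0
  bracket_mem : ∀ i j, ∀ z ∈ U,
    mlieBracket (𝓡 m) (V i) (mlieBracket (𝓡 m) F (V j)) z ∈ D z

end SecondOrderType

/-! Write $D$ for $\mathcal V$ and $W$ for `addBracket F D`. By Frobenius, near a point $z_0$ of the
regular set, $D$ is the common kernel of the differentials of functions $q$, and $W$ that of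
functions $t$. If $X_i$ is a frame of $D$, the vectors $dq([F,X_i])$ are independent at $z_0$, so
some linear image $x = L\circ q$ satisfies $dx([F,X_i]) = -e_i$ there, while $dx$ kills $D$ on a
whole neighbourhood. Put $y = dx(F)$. For $V$ in $D$ one has $dx([F,V]) = F(Vx) - V(Fx) = -dy(V)$,
so $dy(X_i) = e_i$ at $z_0$, and $(t,x,y)$ has injective, hence bijective, differential there.

In these coordinates $D$ lies in $\ker dt\cap\ker dx$, the span of the $\partial/\partial y^i$, and
equals it by dimension. With $V_i = \partial/\partial y^i$ and $W_i = [F,V_i]$, the same identity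
gives $dx(W_i) = -e_i$ on the whole domain, and $dt(W_i)=0$ because $W_i$ lies in $W$. Hence $W_i +
\partial/\partial x^i$ lies in $D$; and $[V_i,W_j]$ lies in $D$, since $dt$ and $dx$ are constant on
both fields. The carriers are `differential_mlieBracket_of_ker`, `exists_adaptedCoordinates` and
`mem_span_coordField_y`.

Frobenius is proved from scratch. A frame is normalised so that its fields commute, and commuting
fields are straightened by a joint flow. Smooth dependence of the flow comes from the inverse
function theorem applied to the integral equation in the Banach space $C([0,1],E)$, which requires
smoothness of $u\mapsto f\circ u$ (`contDiff_superposition`). -/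

open scoped Topology

namespace SecondOrderType

set_option linter.unusedSectionVars false

/-! ### Smoothness of superposition operators on spaces of continuous functions. -/

section Superposition

-- A common universe for `E` and `F` keeps `E →L[ℝ] F` in it, as the induction in
-- `contDiff_nat_superposition` requires.
universe u

variable {K : Type*} [TopologicalSpace K] [CompactSpace K]
  {E F : Type u} [NormedAddCommGroup E] [NormedSpace ℝ E] [NormedAddCommGroup F] [NormedSpace ℝ F]

/-- Pointwise application of a continuous family of continuous linear maps to a continuous
function. -/
noncomputable def pointwiseApply : C(K, E →L[ℝ] F) →L[ℝ] C(K, E) →L[ℝ] C(K, F) :=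
  LinearMap.mkContinuous₂
    (LinearMap.mk₂ ℝ (fun (f : C(K, E →L[ℝ] F)) (v : C(K, E)) =>
        (⟨fun s => f s (v s), f.continuous.clm_apply v.continuous⟩ : C(K, F)))
      (fun _ _ _ => by ext; simp) (fun _ _ _ => by ext; simp)
      (fun _ _ _ => by ext; simp) (fun _ _ _ => by ext; simp)) 1
    (fun f v => by
      refine (ContinuousMap.norm_le _ (by positivity)).2 fun s => ?_
      rw [one_mul]
      exact (f s).le_of_opNorm_le_of_le (f.norm_coe_le_norm s) (v.norm_coe_le_norm s))

@[simp]
theorem pointwiseApply_apply (f : C(K, E →L[ℝ] F)) (v : C(K, E)) (s : K) :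
    pointwiseApply f v s = f s (v s) := rfl

theorem norm_pointwiseApply_le (f : C(K, E →L[ℝ] F)) (v : C(K, E)) :
    ‖pointwiseApply f v‖ ≤ ‖f‖ * ‖v‖ :=
  (ContinuousMap.norm_le _ (by positivity)).2 fun s =>
    (f s).le_of_opNorm_le_of_le (f.norm_coe_le_norm s) (v.norm_coe_le_norm s)

variable (K E) in
/-- Constant functions, as a continuous linear map. -/
noncomputable def constCLM : E →L[ℝ] C(K, E) :=
  LinearMap.mkContinuous
    { toFun := ContinuousMap.const K, map_add' := fun _ _ => rfl, map_smul' := fun _ _ => rfl } 1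
    (fun a => (ContinuousMap.norm_le _ (by positivity)).2 fun _ => (one_mul ‖a‖).ge)

@[simp]
theorem constCLM_apply (a : E) (s : K) : constCLM K E a s = a := rfl

theorem norm_constCLM_le (a : E) : ‖constCLM K E a‖ ≤ ‖a‖ :=
  (ContinuousMap.norm_le _ (by positivity)).2 fun _ => by simp

variable (K) in
/-- The superposition operator `u ↦ f ∘ u` on continuous functions. -/
def superposition (f : E → F) (hf : Continuous f) (u : C(K, E)) : C(K, F) :=
  (⟨f, hf⟩ : C(E, F)).comp u

@[simp]
theorem superposition_apply (f : E → F) (hf : Continuous f) (u : C(K, E)) (s : K) :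
    superposition K f hf u s = f (u s) := rfl

theorem continuous_superposition (f : E → F) (hf : Continuous f) :
    Continuous (superposition K f hf) :=
  ContinuousMap.continuous_postcomp (X := K) (⟨f, hf⟩ : C(E, F))

/-- The mean value inequality is applied at each point of `K`; its bound is uniform because
superposition with `fderiv ℝ f` is continuous at `u`. -/
theorem hasFDerivAt_superposition (f : E → F) (hf : ContDiff ℝ 1 f) (u : C(K, E)) :
    HasFDerivAt (superposition K f hf.continuous)
      (pointwiseApply (superposition K (fderiv ℝ f) (hf.continuous_fderiv one_ne_zero) u)) u := by
  rw [hasFDerivAt_iff_isLittleO_nhds_zero, Asymptotics.isLittleO_iff]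
  intro ε hε
  have hcont := (continuous_superposition (K := K) (fderiv ℝ f)
    (hf.continuous_fderiv one_ne_zero)).continuousAt (x := u)
  obtain ⟨δ, hδ, H⟩ := Metric.continuousAt_iff.1 hcont ε hε
  filter_upwards [Metric.ball_mem_nhds (0 : C(K, E)) hδ] with h hh
  rw [mem_ball_zero_iff] at hh
  refine (ContinuousMap.norm_le _ (by positivity)).2 fun s => ?_
  have hb : ∀ y ∈ Metric.closedBall (u s) ‖h‖, ‖fderiv ℝ f y - fderiv ℝ f (u s)‖ ≤ ε := by
    intro y hy
    -- Translating `u` by the constant `y - u s` gives a function close to `u` with value `y` at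
    -- `s`, so sup-norm continuity controls `fderiv ℝ f y`.
    have h1 : dist (u + constCLM K E (y - u s)) u < δ := by
      rw [dist_eq_norm, add_sub_cancel_left]
      refine (norm_constCLM_le _).trans_lt (lt_of_le_of_lt ?_ hh)
      rwa [← dist_eq_norm]
    have h2 := (ContinuousMap.dist_apply_le_dist s).trans (H h1).le
    simpa [dist_eq_norm] using h2
  have := (convex_closedBall (u s) ‖h‖).norm_image_sub_le_of_norm_fderiv_le' (𝕜 := ℝ)
    (fun x _ => (hf.differentiable one_ne_zero) x) hb
    (Metric.mem_closedBall_self (norm_nonneg h)) (y := u s + h s)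
    (by simpa [dist_eq_norm] using h.norm_coe_le_norm s)
  simp only [add_sub_cancel_left] at this
  exact this.trans (mul_le_mul_of_nonneg_left (h.norm_coe_le_norm s) hε.le)

/-- The derivative is the superposition operator of `fderiv ℝ f` followed by a continuous linear
map, so one order of smoothness is gained at a time. The target `F` varies in the induction, since
`fderiv ℝ f` takes values in `E →L[ℝ] F`. -/
theorem contDiff_nat_superposition (n : ℕ) : ∀ {F : Type u} [NormedAddCommGroup F]
    [NormedSpace ℝ F] (f : E → F) (hf : ContDiff ℝ n f),
    ContDiff ℝ n (superposition K f hf.continuous) := by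
  induction n with
  | zero => exact fun f hf => contDiff_zero.2 (continuous_superposition f hf.continuous)
  | succ n ih =>
    intro F _ _ f hf
    have h1 : ContDiff ℝ 1 f := hf.of_le (by norm_cast; omega)
    have hd : ContDiff ℝ n (fderiv ℝ f) := hf.fderiv_right (by norm_cast)
    exact contDiff_succ_iff_hasFDerivAt.2 ⟨_, pointwiseApply.contDiff.comp (ih (fderiv ℝ f) hd),
      hasFDerivAt_superposition f h1⟩

theorem contDiff_superposition (f : E → F) (hf : ContDiff ℝ ∞ f) :
    ContDiff ℝ ∞ (superposition K f hf.continuous) :=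
  contDiff_infty.2 fun n => contDiff_nat_superposition n f (contDiff_infty.1 hf n)

end Superposition

/-! ### Integration as a bounded operator on continuous functions. -/

section Primitive

variable {E : Type*} [NormedAddCommGroup E] [NormedSpace ℝ E]

/-- The extension to `ℝ`, constant outside of the unit interval, of a continuous function. -/
noncomputable def extendUnit (u : C(unitInterval, E)) : ℝ → E :=
  Set.IccExtend zero_le_one u

theorem continuous_extendUnit (u : C(unitInterval, E)) : Continuous (extendUnit u) :=
  u.continuous.Icc_extend'

@[simp]
theorem extendUnit_coe (u : C(unitInterval, E)) (s : unitInterval) : extendUnit u s = u s :=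
  Set.IccExtend_val _ _ s

/-- The primitive that vanishes at `0` of a continuous function on the unit interval. -/
noncomputable def primitive : C(unitInterval, E) →L[ℝ] C(unitInterval, E) :=
  LinearMap.mkContinuous
    { toFun := fun u => ⟨fun s => ∫ τ in (0 : ℝ)..s, extendUnit u τ,
        (intervalIntegral.continuous_primitive
          (fun a b => (continuous_extendUnit u).intervalIntegrable a b) 0).comp
          continuous_subtype_val⟩
      map_add' := fun u v => by
        ext s
        exact intervalIntegral.integral_add ((continuous_extendUnit u).intervalIntegrable _ _)
          ((continuous_extendUnit v).intervalIntegrable _ _)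
      map_smul' := fun c u => by
        ext s
        exact intervalIntegral.integral_smul c (extendUnit u) } 1
    (fun u => by
      refine (ContinuousMap.norm_le _ (by positivity)).2 fun s => ?_
      have := intervalIntegral.norm_integral_le_of_norm_le_const (a := 0) (b := (s : ℝ))
        (f := extendUnit u) (C := ‖u‖) (fun x _ => u.norm_coe_le_norm _)
      refine this.trans ?_
      rw [one_mul, sub_zero, abs_of_nonneg s.2.1]
      exact mul_le_of_le_one_right (norm_nonneg _) s.2.2)

theorem primitive_apply (u : C(unitInterval, E)) (s : unitInterval) :
    primitive u s = ∫ τ in (0 : ℝ)..s, extendUnit u τ := rfl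

theorem norm_primitive_le (u : C(unitInterval, E)) : ‖primitive u‖ ≤ ‖u‖ := by
  simpa using (primitive (E := E)).le_of_opNorm_le (LinearMap.mkContinuous_norm_le _ zero_le_one _) u

end Primitive

/-- The inverse function theorem, with smoothness of the inverse on its whole domain. -/
theorem exists_smooth_localInverse {E F : Type*} [NormedAddCommGroup E] [NormedSpace ℝ E]
    [CompleteSpace E] [NormedAddCommGroup F] [NormedSpace ℝ F] {f : E → F} {a : E}
    (hf : ∀ᶠ x in 𝓝 a, ContDiffAt ℝ ∞ f x) (e : E ≃L[ℝ] F)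
    (he : HasFDerivAt f (e : E →L[ℝ] F) a) :
    ∃ h : OpenPartialHomeomorph E F, a ∈ h.source ∧ (h : E → F) = f ∧
      (∀ x ∈ h.source, ContDiffAt ℝ ∞ f x) ∧ ∀ y ∈ h.target, ContDiffAt ℝ ∞ h.symm y := by
  have ha := hf.self_of_nhds
  have hinv : ∀ᶠ x in 𝓝 a, fderiv ℝ f x ∈ Set.range ((↑) : (E ≃L[ℝ] F) → E →L[ℝ] F) := by
    have h1 : ContinuousAt (fderiv ℝ f) a :=
      (ha.fderiv_right (m := ∞) (by simp)).continuousAt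
    exact h1.eventually (by rw [he.fderiv]; exact ContinuousLinearEquiv.nhds e)
  -- Invertibility of the derivative is an open condition; after restriction to `O` the inverse is
  -- smooth at every point of its domain and not only at the image of `a`.
  obtain ⟨O, hOsub, hO, haO⟩ := eventually_nhds_iff.1 (hf.and hinv)
  set h := (ha.toOpenPartialHomeomorph f he (by simp)).restrOpen O hO
  refine ⟨h, ⟨ha.mem_toOpenPartialHomeomorph_source he (by simp), haO⟩, rfl,
    fun x hx => (hOsub x hx.2).1, fun y hy => ?_⟩
  have hx := hOsub _ (h.map_target hy).2
  obtain ⟨e', he'⟩ := hx.2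
  refine h.contDiffAt_symm hy (f₀' := e') ?_ hx.1
  rw [he']
  exact (hx.1.differentiableAt (by simp)).hasFDerivAt

/-! ### Joint flows of commuting vector fields and their smooth dependence on the data. -/

section Flow

universe u

variable {A E : Type u} [NormedAddCommGroup A] [NormedSpace ℝ A] [CompleteSpace A]
  [NormedAddCommGroup E] [NormedSpace ℝ E] [CompleteSpace E]

/-- The integral operator whose fixed points are the solutions of `u' = σ(u) a`, `u(0) = x`. -/
noncomputable def picardMap (σ : E → A →L[ℝ] E) (hσ : ContDiff ℝ ∞ σ)
    (z : (A × E) × C(unitInterval, E)) : C(unitInterval, E) :=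
  constCLM _ E z.1.2 + primitive (pointwiseApply (superposition _ σ hσ.continuous z.2)
    (constCLM unitInterval A z.1.1))

theorem contDiff_picardMap (σ : E → A →L[ℝ] E) (hσ : ContDiff ℝ ∞ σ) :
    ContDiff ℝ ∞ (picardMap σ hσ) := by
  have h1 := (contDiff_superposition (K := unitInterval) σ hσ).comp
    (contDiff_snd (𝕜 := ℝ) (E := A × E) (F := C(unitInterval, E)))
  have h2 : ContDiff ℝ ∞ fun z : (A × E) × C(unitInterval, E) => constCLM unitInterval A z.1.1 :=
    (constCLM unitInterval A).contDiff.comp (contDiff_fst.comp contDiff_fst)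
  have h3 : ContDiff ℝ ∞ fun z : (A × E) × C(unitInterval, E) => constCLM unitInterval E z.1.2 :=
    (constCLM unitInterval E).contDiff.comp (contDiff_snd.comp contDiff_fst)
  have h4 : ContDiff ℝ ∞ fun z : (A × E) × C(unitInterval, E) =>
      pointwiseApply (superposition unitInterval σ hσ.continuous z.2)
        (constCLM unitInterval A z.1.1) :=
    (ContDiff.comp (g := pointwiseApply (K := unitInterval) (E := A) (F := E))
      (ContinuousLinearMap.contDiff _) h1).clm_apply h2
  exact h3.add ((primitive (E := E)).contDiff.comp h4)

/-- Smooth dependence of the solutions of `u' = σ(u) a`, `u(0) = x` on `(a, x)`. -/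
theorem exists_smooth_solution (σ : E → A →L[ℝ] E) (hσ : ContDiff ℝ ∞ σ) (p : E) :
    ∃ ψ : A × E → C(unitInterval, E), (∀ᶠ z in 𝓝 ((0 : A), p), ContDiffAt ℝ ∞ ψ z) ∧
      ψ (0, p) = constCLM _ E p ∧
      ∀ᶠ z in 𝓝 ((0 : A), p), picardMap σ hσ (z, ψ z) = ψ z := by
  set G : (A × E) × C(unitInterval, E) → C(unitInterval, E) := fun z => z.2 - picardMap σ hσ z
  have hG : ContDiff ℝ ∞ G := contDiff_snd.sub (contDiff_picardMap σ hσ)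
  -- At `a = 0` the integral term vanishes, so the partial derivative of `G` in `u` is the identity.
  -- Smallness of the parameter `a` thus replaces smallness of the time interval.
  have hP : ∀ u, picardMap σ hσ (((0 : A), p), u) = constCLM _ E p := by
    intro u
    simp [picardMap]
  have hG0 : G (((0 : A), p), constCLM _ E p) = 0 := by simp [G, hP]
  set G' := fderiv ℝ G ((0, p), constCLM _ E p)
  have hGd : HasFDerivAt G G' ((0, p), constCLM _ E p) :=
    (hG.differentiable (by simp) _).hasFDerivAt
  have hG' : ∀ v, G' (0, v) = v := by
    intro v
    have h1 : HasFDerivAt (fun u : C(unitInterval, E) => (((0 : A), p), u))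
        (ContinuousLinearMap.inr ℝ (A × E) C(unitInterval, E)) (constCLM _ E p) :=
      hasFDerivAt_prodMk_right _ _
    have h2 := hGd.comp _ h1
    have h3 : HasFDerivAt (G ∘ fun u : C(unitInterval, E) => (((0 : A), p), u))
        (ContinuousLinearMap.id ℝ _) (constCLM _ E p) := by
      have : (G ∘ fun u : C(unitInterval, E) => (((0 : A), p), u)) =
          fun u => u - constCLM _ E p := by
        ext1 u
        simp [G, hP]
      rw [this]
      exact (hasFDerivAt_id _).sub_const _
    exact congrArg (fun l => l v) (h2.unique h3)
  have hsplit : ∀ z : (A × E) × C(unitInterval, E), G' z = G' (z.1, 0) + z.2 := by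
    intro z
    conv_lhs => rw [show z = (z.1, 0) + (0, z.2) by simp]
    rw [map_add, hG']
  -- The derivative of `(z, u) ↦ (z, G (z, u))` is block triangular with identity diagonal blocks,
  -- which gives the inverse explicitly.
  let e : ((A × E) × C(unitInterval, E)) ≃L[ℝ] ((A × E) × C(unitInterval, E)) :=
    ContinuousLinearEquiv.equivOfInverse
      ((ContinuousLinearMap.fst ℝ (A × E) C(unitInterval, E)).prod G')
      ((ContinuousLinearMap.fst ℝ (A × E) C(unitInterval, E)).prod
        (ContinuousLinearMap.snd ℝ (A × E) C(unitInterval, E) -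
          G' ∘L (ContinuousLinearMap.inl ℝ (A × E) C(unitInterval, E)) ∘L
            ContinuousLinearMap.fst ℝ (A × E) C(unitInterval, E)))
      (fun z => Prod.ext rfl (by simp [hsplit z]))
      (fun z => Prod.ext rfl (by
        change G' (z.1, z.2 - G' (z.1, 0)) = z.2
        rw [hsplit]
        simp))
  have hH : ContDiff ℝ ∞ fun z : (A × E) × C(unitInterval, E) => (z.1, G z) :=
    contDiff_fst.prodMk hG
  obtain ⟨h, hmem, hcoe, -, hsymm⟩ := exists_smooth_localInverse
    (Filter.Eventually.of_forall fun z => hH.contDiffAt (x := z)) e (hasFDerivAt_fst.prodMk hGd)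
  have hbase : h (((0 : A), p), constCLM _ E p) = (((0 : A), p), 0) := by
    rw [hcoe]
    exact Prod.ext rfl hG0
  have hnear : ∀ᶠ z in 𝓝 ((0 : A), p), (z, (0 : C(unitInterval, E))) ∈ h.target := by
    have h1 : ContinuousAt (fun z : A × E => (z, (0 : C(unitInterval, E)))) (0, p) := by fun_prop
    refine h1.eventually (h.open_target.mem_nhds ?_)
    change (((0 : A), p), (0 : C(unitInterval, E))) ∈ h.target
    rw [← hbase]
    exact h.map_source hmem
  refine ⟨fun z => (h.symm (z, 0)).2, ?_, ?_, ?_⟩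
  · filter_upwards [hnear] with z hz
    exact contDiffAt_snd.comp z ((hsymm _ hz).comp z
      (contDiff_id.prodMk contDiff_const).contDiffAt)
  · change (h.symm (((0 : A), p), 0)).2 = _
    rw [← hbase, h.left_inv hmem]
  · filter_upwards [hnear] with z hz
    have h1 := h.right_inv hz
    rw [hcoe] at h1
    have h2 : (h.symm (z, 0)).1 = z := congrArg Prod.fst h1
    have h3 : G (h.symm (z, 0)) = 0 := congrArg Prod.snd h1
    have h4 : h.symm (z, 0) = (z, (h.symm (z, 0)).2) := Prod.ext h2 rfl
    rw [h4] at h3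
    exact (sub_eq_zero.1 h3).symm

/-- The initial-value derivative of a solution in the direction of a commuting field. -/
theorem variation_eq_primitive (σ : E → A →L[ℝ] E) (hσ : ContDiff ℝ ∞ σ) {a : A} {x : E}
    {u : C(unitInterval, E)} (hu : picardMap σ hσ ((a, x), u) = u)
    (hcomm : ∀ s, ∀ a b, fderiv ℝ σ (u s) (σ (u s) a) b = fderiv ℝ σ (u s) (σ (u s) b) a)
    (δ : A) (c : C(unitInterval, E)) (hc : ∀ s, c s = (s : ℝ) • σ (u s) δ) :
    c = primitive (pointwiseApply (pointwiseApply (superposition _ (fderiv ℝ σ)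
        (hσ.continuous_fderiv (by simp)) u) c) (constCLM _ A a) +
      pointwiseApply (superposition _ σ hσ.continuous u) (constCLM _ A δ)) := by
  set v := pointwiseApply (superposition _ σ hσ.continuous u) (constCLM unitInterval A a) with hv
  -- `U` extends `u` to the whole line as a differentiable function, so no one-sided derivatives
  -- occur at the ends of the interval.
  set U : ℝ → E := fun s => x + ∫ τ in (0 : ℝ)..s, extendUnit v τ with hU
  have hUu : ∀ s : unitInterval, U s = u s := fun s => by
    conv_rhs => rw [← hu]
    rfl
  have hUd : ∀ s : ℝ, HasDerivAt U (extendUnit v s) s := fun s =>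
    (intervalIntegral.integral_hasDerivAt_right
      ((continuous_extendUnit v).intervalIntegrable _ _)
      (continuous_extendUnit v).stronglyMeasurable.stronglyMeasurableAtFilter
      (continuous_extendUnit v).continuousAt).const_add x
  have hσd : ∀ y, HasFDerivAt σ (fderiv ℝ σ y) y := fun y =>
    (hσ.differentiable (by simp) y).hasFDerivAt
  set w := pointwiseApply (pointwiseApply (superposition _ (fderiv ℝ σ)
        (hσ.continuous_fderiv (by simp)) u) c) (constCLM _ A a) +
      pointwiseApply (superposition _ σ hσ.continuous u) (constCLM _ A δ) with hw
  have hder : ∀ s ∈ Set.Icc (0 : ℝ) 1,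
      HasDerivAt (fun s => s • σ (U s) δ) (extendUnit w s) s := by
    intro s hs
    have h1 : HasDerivAt (fun s => σ (U s)) (fderiv ℝ σ (U s) (extendUnit v s)) s :=
      (hσd (U s)).comp_hasDerivAt s (hUd s)
    have h2 := (hasDerivAt_id s).smul (h1.clm_apply (hasDerivAt_const s δ))
    refine h2.congr_deriv ?_
    have e1 := extendUnit_coe w ⟨s, hs⟩
    have e2 := extendUnit_coe v ⟨s, hs⟩
    have e3 := hUu ⟨s, hs⟩
    simp only at e1 e2 e3
    rw [e1, e2, e3]
    simp only [hw, hv, ContinuousMap.add_apply, pointwiseApply_apply, superposition_apply,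
      constCLM_apply, hc, map_smul, smul_apply, id, one_smul, map_zero,
      add_zero]
    -- Differentiating $s\,\sigma(u)\delta$ produces $s\,D\sigma(u)(\sigma(u)a)\delta$; commutation
    -- exchanges `a` and `δ` and turns it into $D\sigma(u)(c)a$, the term of the variational
    -- equation.
    rw [hcomm]
  ext s
  rw [primitive_apply, intervalIntegral.integral_eq_sub_of_hasDerivAt (f := fun s => s • σ (U s) δ)]
  · simp [hc, hUu]
  · intro r hr
    rw [Set.uIcc_of_le s.2.1] at hr
    exact hder r ⟨hr.1, hr.2.trans s.2.2⟩
  · exact (continuous_extendUnit w).intervalIntegrable _ _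

/-- The variational equation satisfied by the derivatives of a solution. -/
theorem fderiv_solution (σ : E → A →L[ℝ] E) (hσ : ContDiff ℝ ∞ σ)
    {ψ : A × E → C(unitInterval, E)} {z : A × E}
    (hfix : ∀ᶠ y in 𝓝 z, picardMap σ hσ (y, ψ y) = ψ y) (hψ : DifferentiableAt ℝ ψ z) (δ : A) :
    fderiv ℝ ψ z (δ, 0) = primitive (pointwiseApply (pointwiseApply (superposition _ (fderiv ℝ σ)
        (hσ.continuous_fderiv (by simp)) (ψ z)) (fderiv ℝ ψ z (δ, 0))) (constCLM _ A z.1) +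
      pointwiseApply (superposition _ σ hσ.continuous (ψ z)) (constCLM _ A δ)) := by
  have h1 := (hasFDerivAt_superposition σ (hσ.of_le (by simp)) (ψ z)).comp z hψ.hasFDerivAt
  have h2' : HasFDerivAt (pointwiseApply (K := unitInterval) (E := A) (F := E)) pointwiseApply
      (superposition unitInterval σ hσ.continuous (ψ z)) := ContinuousLinearMap.hasFDerivAt _
  have h2 := HasFDerivAt.comp (g := pointwiseApply (K := unitInterval) (E := A) (F := E))
    (f := fun z => superposition unitInterval σ hσ.continuous (ψ z)) z h2' h1
  have h3 := ((constCLM unitInterval A).hasFDerivAt (x := z.1)).comp z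
    (hasFDerivAt_fst (𝕜 := ℝ) (E := A) (F := E) (p := z))
  have h4 := ((constCLM unitInterval E).hasFDerivAt (x := z.2)).comp z
    (hasFDerivAt_snd (𝕜 := ℝ) (E := A) (F := E) (p := z))
  have h5 := h4.add ((primitive (E := E)).hasFDerivAt (x := pointwiseApply
    (superposition unitInterval σ hσ.continuous (ψ z)) (constCLM unitInterval A z.1))
    |>.comp z (h2.clm_apply h3))
  have h6 : HasFDerivAt ψ _ z := h5.congr_of_eventuallyEq (by
    filter_upwards [hfix] with y hy
    exact hy.symm)
  refine (congrArg (fun l => l ((δ, 0) : A × E)) h6.fderiv).trans ?_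
  change constCLM unitInterval E 0 + primitive (pointwiseApply (superposition _ σ hσ.continuous
    (ψ z)) (constCLM _ A δ) + pointwiseApply (pointwiseApply (superposition _ (fderiv ℝ σ)
        (hσ.continuous_fderiv (by simp)) (ψ z)) (fderiv ℝ ψ z (δ, 0))) (constCLM _ A z.1)) = _
  rw [map_zero, zero_add, add_comm]

/-- A smooth simultaneous straightening of commuting vector fields. -/
theorem exists_smooth_flow (σ : E → A →L[ℝ] E) (hσ : ContDiff ℝ ∞ σ) (p : E)
    (hcomm : ∀ᶠ y in 𝓝 p, ∀ a b, fderiv ℝ σ y (σ y a) b = fderiv ℝ σ y (σ y b) a) :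
    ∃ Φ : A × E → E, (∀ᶠ z in 𝓝 ((0 : A), p), ContDiffAt ℝ ∞ Φ z) ∧ (∀ᶠ x in 𝓝 p, Φ (0, x) = x) ∧
      ∀ᶠ z in 𝓝 ((0 : A), p), ∀ δ, fderiv ℝ Φ z (δ, 0) = σ (Φ z) δ := by
  obtain ⟨ψ, hψe, hψ0, hfix⟩ := exists_smooth_solution σ hσ p
  have hψ := hψe.self_of_nhds
  -- `Φ (a, x)` is the time-one value of the solution of `u' = σ(u) a` starting at `x`.
  set ev : C(unitInterval, E) →L[ℝ] E := ContinuousMap.evalCLM ℝ (1 : unitInterval)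
  refine ⟨fun z => ev (ψ z), hψe.mono fun z hz => ev.contDiff.contDiffAt.comp _ hz, ?_, ?_⟩
  · have h1 : Filter.Tendsto (fun x : E => ((0 : A), x)) (𝓝 p) (𝓝 (0, p)) :=
      (Continuous.prodMk_right (0 : A)).continuousAt
    filter_upwards [h1.eventually hfix] with x hx
    rw [← hx]
    simp [picardMap, ev]
  obtain ⟨r, hr, hball⟩ := Metric.eventually_nhds_iff_ball.1 hcomm
  have hnear : ∀ᶠ z in 𝓝 ((0 : A), p), ψ z ∈ Metric.ball (constCLM unitInterval E p) r :=
    hψ.continuousAt.eventually (by rw [hψ0]; exact Metric.ball_mem_nhds _ hr)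
  have hdiff : ∀ᶠ z in 𝓝 ((0 : A), p), DifferentiableAt ℝ ψ z :=
    hψe.mono fun z hz => hz.differentiableAt (by simp)
  have hdσ := hσ.continuous_fderiv (by simp)
  -- The product is zero at `a = 0`. Being less than one makes the linear variational equation a
  -- contraction, which gives uniqueness of its solution.
  have hsmall : ∀ᶠ z in 𝓝 ((0 : A), p),
      ‖superposition unitInterval (fderiv ℝ σ) hdσ (ψ z)‖ * ‖z.1‖ < 1 := by
    have : ContinuousAt (fun z : A × E =>
        ‖superposition unitInterval (fderiv ℝ σ) hdσ (ψ z)‖ * ‖z.1‖) (0, p) :=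
      ((continuous_superposition (fderiv ℝ σ) hdσ).continuousAt.comp hψ.continuousAt).norm.mul
        continuousAt_fst.norm
    exact this.eventually (gt_mem_nhds (by simp))
  filter_upwards [hfix, hfix.eventually_nhds, hnear, hdiff, hsmall] with z hz hz' hzn hzd hzs δ
  set w := fderiv ℝ ψ z (δ, 0) with hw
  have hgoal : fderiv ℝ (fun z => ev (ψ z)) z (δ, 0) = ev w := by
    have h := ev.hasFDerivAt.comp z hzd.hasFDerivAt
    exact congrArg (fun l => l ((δ, 0) : A × E)) h.fderiv
  rw [hgoal]
  set dσ := superposition unitInterval (fderiv ℝ σ) hdσ (ψ z)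
  have hvar := fderiv_solution σ hσ hz' hzd δ
  rw [← hw] at hvar
  set c : C(unitInterval, E) := ⟨fun s => (s : ℝ) • σ (ψ z s) δ, by
    have := hσ.continuous
    fun_prop⟩ with hcdef
  have hc := variation_eq_primitive σ hσ hz (fun s => hball _ (by
    rw [Metric.mem_ball] at hzn ⊢
    exact (ContinuousMap.dist_apply_le_dist s).trans_lt hzn)) δ c (fun s => rfl)
  -- Both `w` and `c` solve the variational equation; their difference solves the homogeneous one
  -- and vanishes by contraction.
  have hwc : w = c := by
    have e : w - c = primitive (pointwiseApply (pointwiseApply dσ (w - c)) (constCLM _ A z.1)) := by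
      conv_lhs => rw [hvar, hc]
      rw [← map_sub, add_sub_add_right_eq_sub]
      simp only [map_sub, sub_apply]
      rfl
    have hle : ‖w - c‖ ≤ ‖dσ‖ * ‖z.1‖ * ‖w - c‖ := by
      conv_lhs => rw [e]
      refine (norm_primitive_le _).trans ((norm_pointwiseApply_le _ _).trans ?_)
      calc _ ≤ (‖dσ‖ * ‖w - c‖) * ‖z.1‖ := mul_le_mul (norm_pointwiseApply_le _ _)
            (norm_constCLM_le _) (norm_nonneg _) (by positivity)
        _ = _ := by ring
    have : ‖w - c‖ = 0 := by
      by_contra h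
      have hpos : 0 < ‖w - c‖ := lt_of_le_of_ne (norm_nonneg _) (Ne.symm h)
      nlinarith
    exact sub_eq_zero.1 (norm_eq_zero.1 this)
  rw [hwc]
  simp [ev, hcdef]

end Flow

/-! ### The Frobenius theorem in a vector space. -/

section VectorSpaceFrobenius

variable {E : Type} [NormedAddCommGroup E] [NormedSpace ℝ E] [FiniteDimensional ℝ E]

/-- A smooth function on an open set agrees near each point with a globally smooth function. -/
theorem exists_contDiff_eventuallyEq {G : Type*} [NormedAddCommGroup G] [NormedSpace ℝ G]
    {f : E → G} {O : Set E} (hf : ContDiffOn ℝ ∞ f O) {p : E} (hO : O ∈ 𝓝 p) :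
    ∃ g : E → G, ContDiff ℝ ∞ g ∧ g =ᶠ[𝓝 p] f := by
  obtain ⟨r, hr, hball⟩ := Metric.mem_nhds_iff.1 hO
  let χ : ContDiffBump p := ⟨r / 4, r / 2, by positivity, by linarith⟩
  refine ⟨fun x => χ x • f x, contDiff_iff_contDiffAt.2 fun x => ?_, ?_⟩
  · by_cases hx : x ∈ Metric.ball p r
    · exact χ.contDiffAt.smul ((hf.mono hball).contDiffAt (Metric.isOpen_ball.mem_nhds hx))
    · have h0 : (fun x => χ x • f x) =ᶠ[𝓝 x] fun _ => 0 := by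
        have hx' : x ∉ tsupport χ := by
          rw [χ.tsupport_eq]
          intro h
          exact hx (Metric.closedBall_subset_ball (by change r / 2 < r; linarith) h)
        filter_upwards [(notMem_tsupport_iff_eventuallyEq).1 hx'] with y hy
        simp [hy]
      exact contDiffAt_const.congr_of_eventuallyEq h0
  · filter_upwards [χ.eventuallyEq_one] with x hx
    simp [hx]

/-- Commuting vector fields, given as a smooth family of injective linear maps, have a complete
set of first integrals. -/
theorem exists_firstIntegrals_of_commute {A : Type} [NormedAddCommGroup A] [NormedSpace ℝ A]
    [FiniteDimensional ℝ A] (σ : E → A →L[ℝ] E) (hσ : ContDiff ℝ ∞ σ) (p : E)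
    (hcomm : ∀ᶠ y in 𝓝 p, ∀ a b, fderiv ℝ σ y (σ y a) b = fderiv ℝ σ y (σ y b) a)
    (P : E →L[ℝ] A) (hP : ∀ a, P (σ p a) = a) :
    ∃ f : E → P.ker, (∀ᶠ x in 𝓝 p, ContDiffAt ℝ ∞ f x) ∧
      ∀ᶠ x in 𝓝 p, (fderiv ℝ f x).ker = (σ x).range := by
  have := FiniteDimensional.complete ℝ E
  have := FiniteDimensional.complete ℝ A
  have := FiniteDimensional.complete ℝ P.ker
  obtain ⟨Φ, hΦe, hΦ0, hΦσ⟩ := exists_smooth_flow σ hσ p hcomm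
  have hΦ := hΦe.self_of_nhds
  set j : A × P.ker → A × E := fun z => (z.1, p + z.2) with hj
  have hj0 : j 0 = (0, p) := by simp [hj]
  have hjd : ContDiff ℝ ∞ j := by
    refine contDiff_fst.prodMk (contDiff_const.add ?_)
    exact P.ker.subtypeL.contDiff.comp contDiff_snd
  have hjf : ∀ z, HasFDerivAt j ((ContinuousLinearMap.fst ℝ A P.ker).prod
      (P.ker.subtypeL ∘L ContinuousLinearMap.snd ℝ A P.ker)) z := fun z =>
    hasFDerivAt_fst.prodMk ((P.ker.subtypeL.hasFDerivAt.comp z hasFDerivAt_snd).const_add p)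
  -- The affine slice `p + P.ker` is transverse to the range of `σ p`; flowing it along the
  -- commuting fields gives straightening coordinates, and the `P.ker` component of the inverse of
  -- `Ψ` gives the first integrals.
  set Ψ : A × P.ker → E := Φ ∘ j with hΨdef
  have hΨ0 : Ψ 0 = p := by
    simp only [hΨdef, Function.comp, hj0]
    exact hΦ0.self_of_nhds
  have ht : Filter.Tendsto j (𝓝 0) (𝓝 (0, p)) := by
    rw [← hj0]
    exact hjd.continuous.continuousAt
  have hΨe : ∀ᶠ z in 𝓝 (0 : A × P.ker), ContDiffAt ℝ ∞ Ψ z :=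
    (ht.eventually hΦe).mono fun z hz => hz.comp z hjd.contDiffAt
  have hΨ := hΨe.self_of_nhds
  have hΨσ : ∀ᶠ z in 𝓝 (0 : A × P.ker), DifferentiableAt ℝ Ψ z ∧
      ∀ δ, fderiv ℝ Ψ z (δ, 0) = σ (Ψ z) δ := by
    have hd : ∀ᶠ z in 𝓝 ((0 : A), p), DifferentiableAt ℝ Φ z :=
      hΦe.mono fun z hz => hz.differentiableAt (by simp)
    filter_upwards [ht.eventually hd, ht.eventually hΦσ] with z hz hzσ
    have h := hz.hasFDerivAt.comp z (hjf z)
    refine ⟨h.differentiableAt, fun δ => ?_⟩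
    rw [h.fderiv]
    simpa [hΨdef] using hzσ δ
  -- The derivative at the origin is $(a,b)\mapsto\sigma(p)a+b$, bijective because `P` is a left
  -- inverse of `σ p`.
  have hΨ' : fderiv ℝ Ψ 0 = (σ p ∘L ContinuousLinearMap.fst ℝ A P.ker) +
      P.ker.subtypeL ∘L ContinuousLinearMap.snd ℝ A P.ker := by
    have h1 : ∀ x, fderiv ℝ Φ (0, p) (0, x) = x := by
      intro x
      have hd : DifferentiableAt ℝ Φ (0, p) := hΦ.differentiableAt (by simp)
      have h := HasFDerivAt.comp (f := fun y : E => ((0 : A), y)) p hd.hasFDerivAt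
        (hasFDerivAt_prodMk_right (0 : A) p)
      have h' : HasFDerivAt (fun x : E => x) _ p := h.congr_of_eventuallyEq (by
        filter_upwards [hΦ0] with y hy
        exact hy.symm)
      have := congrArg (fun l => l x) (h'.unique (hasFDerivAt_id p))
      simpa using this
    refine ContinuousLinearMap.ext fun z => ?_
    obtain ⟨a, b⟩ := z
    have e : ((a, b) : A × P.ker) = (a, 0) + (0, b) := by simp
    rw [e, map_add, hΨσ.self_of_nhds.2 a, hΨ0]
    have hd : DifferentiableAt ℝ Φ (j 0) := by
      rw [hj0]
      exact hΦ.differentiableAt (by simp)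
    have h := hd.hasFDerivAt.comp 0 (hjf 0)
    rw [h.fderiv, hj0]
    simp [h1]
  set T := fderiv ℝ Ψ 0 with hT
  have hinj : T.ker = ⊥ := by
    refine (LinearMap.ker_eq_bot').2 ?_
    rintro ⟨a, b⟩ h
    rw [hΨ'] at h
    replace h : σ p a + (b : E) = 0 := h
    have h2 := congrArg P h
    have hb : P (b : E) = 0 := b.2
    rw [map_add, hP, hb, add_zero, map_zero] at h2
    subst h2
    simpa using h
  have hsurj : T.range = ⊤ := by
    refine LinearMap.range_eq_top.2 fun x => ?_
    refine ⟨(P x, ⟨x - σ p (P x), ?_⟩), ?_⟩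
    · change P _ = 0
      rw [map_sub, hP, sub_self]
    · simp [hΨ']
  let e := ContinuousLinearEquiv.ofBijective T hinj hsurj
  have he : HasFDerivAt Ψ (e : A × P.ker →L[ℝ] E) 0 := by
    have : (e : A × P.ker →L[ℝ] E) = T := ContinuousLinearEquiv.coe_ofBijective T hinj hsurj
    rw [this]
    exact (hΨ.differentiableAt (by simp)).hasFDerivAt
  obtain ⟨h, hmem, hcoe, -, hsymm⟩ := exists_smooth_localInverse hΨe e he
  have hpt : p ∈ h.target := by
    have := h.map_source hmem
    rwa [hcoe, hΨ0] at this
  have hg0 : h.symm p = 0 := by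
    have := h.left_inv hmem
    rwa [hcoe, hΨ0] at this
  have hg := hsymm p hpt
  have hge : ∀ᶠ x in 𝓝 p, ContDiffAt ℝ ∞ h.symm x :=
    Filter.eventually_of_mem (h.open_target.mem_nhds hpt) hsymm
  refine ⟨fun x => (h.symm x).2, hge.mono fun x hx => contDiffAt_snd.comp x hx, ?_⟩
  have hgt : Filter.Tendsto h.symm (𝓝 p) (𝓝 0) := by
    rw [← hg0]
    exact hg.continuousAt
  have hgd : ∀ᶠ x in 𝓝 p, DifferentiableAt ℝ h.symm x :=
    hge.mono fun x hx => hx.differentiableAt (by simp)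
  filter_upwards [hgt.eventually hΨσ, hgd, h.open_target.mem_nhds hpt] with x hx hxd hxt
  have hxx : Ψ (h.symm x) = x := by
    rw [← hcoe]
    exact h.right_inv hxt
  have hr : fderiv ℝ Ψ (h.symm x) ∘L fderiv ℝ h.symm x = ContinuousLinearMap.id ℝ E := by
    have h1 := hx.1.hasFDerivAt.comp x hxd.hasFDerivAt
    refine h1.unique ((hasFDerivAt_id x).congr_of_eventuallyEq ?_)
    filter_upwards [h.open_target.mem_nhds hxt] with y hy
    rw [← hcoe]
    exact h.right_inv hy
  have hl : fderiv ℝ h.symm x ∘L fderiv ℝ Ψ (h.symm x) = ContinuousLinearMap.id ℝ _ := by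
    have h1 := HasFDerivAt.comp (g := h.symm) (f := Ψ) (h.symm x)
      (by rw [hxx]; exact hxd.hasFDerivAt) hx.1.hasFDerivAt
    refine h1.unique ((hasFDerivAt_id _).congr_of_eventuallyEq ?_)
    filter_upwards [h.open_source.mem_nhds (h.map_target hxt)] with y hy
    rw [← hcoe]
    exact h.left_inv hy
  have hf : fderiv ℝ (fun x => (h.symm x).2) x =
      ContinuousLinearMap.snd ℝ A P.ker ∘L fderiv ℝ h.symm x :=
    (hasFDerivAt_snd.comp x hxd.hasFDerivAt).fderiv
  rw [hf]
  ext v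
  constructor
  · intro hv
    have hv' : (fderiv ℝ h.symm x v).2 = 0 := hv
    refine ⟨(fderiv ℝ h.symm x v).1, ?_⟩
    have h2 := hx.2 (fderiv ℝ h.symm x v).1
    rw [hxx] at h2
    have h3 : ((fderiv ℝ h.symm x v).1, (0 : P.ker)) = fderiv ℝ h.symm x v :=
      Prod.ext rfl hv'.symm
    rw [h3] at h2
    have h4 := congrArg (fun l => l v) hr
    exact h2.symm.trans h4
  · rintro ⟨δ, rfl⟩
    have h2 := hx.2 δ
    rw [hxx] at h2
    have h4 := congrArg (fun l => l ((δ, 0) : A × P.ker)) hl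
    change (fderiv ℝ h.symm x (σ x δ)).2 = 0
    rw [← h2]
    exact congrArg Prod.snd h4

/-- The Frobenius theorem in a vector space: an involutive distribution has a complete set of first
integrals. -/
theorem exists_firstIntegrals_vectorSpace {d : ℕ} (hd : Module.finrank ℝ E = d) {ι : Type}
    [Fintype ι] (X : ι → E → E) {O : Set E}
    (hO : IsOpen O) {p : E} (hp : p ∈ O) (hX : ∀ i, ContDiffOn ℝ ∞ (X i) O)
    (hli : LinearIndependent ℝ fun i => X i p)
    (hinv : ∀ O' ⊆ O, IsOpen O' → ∀ Y Z : E → E, ContDiffOn ℝ ∞ Y O' → ContDiffOn ℝ ∞ Z O' →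
      (∀ x ∈ O', Y x ∈ Submodule.span ℝ (Set.range fun i => X i x)) →
      (∀ x ∈ O', Z x ∈ Submodule.span ℝ (Set.range fun i => X i x)) →
      ∀ x ∈ O', lieBracket ℝ Y Z x ∈ Submodule.span ℝ (Set.range fun i => X i x)) :
    ∃ f : E → EuclideanSpace ℝ (Fin (d - Fintype.card ι)),
      (∀ᶠ x in 𝓝 p, ContDiffAt ℝ ∞ f x) ∧ ∀ᶠ x in 𝓝 p,
        (fderiv ℝ f x).ker = Submodule.span ℝ (Set.range fun i => X i x) := by
  have := FiniteDimensional.complete ℝ E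
  subst hd
  set S : E → (ι → ℝ) →L[ℝ] E := fun x =>
    ∑ i, (ContinuousLinearMap.proj (R := ℝ) (φ := fun _ : ι => ℝ) i).smulRight (X i x) with hS
  have hSa : ∀ x c, S x c = ∑ i, c i • X i x := by
    intro x c
    simp [hS]
  have hSr : ∀ x, (S x).range = Submodule.span ℝ (Set.range fun i => X i x) := by
    intro x
    ext v
    rw [Submodule.mem_span_range_iff_exists_fun]
    exact exists_congr fun c => by rw [← hSa]; rfl
  have hSd : ContDiffOn ℝ ∞ S O := by
    refine ContDiffOn.sum fun i _ => ?_
    exact (ContinuousLinearMap.smulRightL ℝ (ι → ℝ) E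
      (ContinuousLinearMap.proj (R := ℝ) (φ := fun _ : ι => ℝ) i)).contDiff.comp_contDiffOn (hX i)
  obtain ⟨P', hP'⟩ := (S p).toLinearMap.exists_leftInverse_of_injective (by
    refine LinearMap.ker_eq_bot'.2 fun c hc => ?_
    have := Fintype.linearIndependent_iff.1 hli c (by rw [← hSa]; exact hc)
    exact funext this)
  set P : E →L[ℝ] (ι → ℝ) := LinearMap.toContinuousLinearMap P' with hP
  have hPS : P ∘L S p = ContinuousLinearMap.id ℝ _ := by
    ext1 c
    exact congrArg (fun l => l c) hP'
  set N : E → (ι → ℝ) →L[ℝ] (ι → ℝ) := fun x => P ∘L S x with hN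
  have hNd : ContDiffOn ℝ ∞ N O :=
    (ContinuousLinearMap.compL ℝ (ι → ℝ) E (ι → ℝ) P).contDiff.comp_contDiffOn hSd
  have hNinv : ∀ᶠ x in 𝓝 p, (N x).IsInvertible := by
    have h1 : ContinuousAt N p := hNd.continuousOn.continuousAt (hO.mem_nhds hp)
    have h2 : N p = (ContinuousLinearEquiv.refl ℝ (ι → ℝ) : (ι → ℝ) →L[ℝ] (ι → ℝ)) := hPS
    exact h1.eventually (by rw [h2]; exact ContinuousLinearEquiv.nhds _)
  obtain ⟨O₁, hO₁sub, hO₁, hpO₁⟩ := eventually_nhds_iff.1 (hNinv.and (hO.mem_nhds hp))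
  -- Change of frame within the same span, normalised by `P ∘ σ₀ = id`: the `P`-components of the
  -- new fields are constant, which forces them to commute.
  set σ₀ : E → (ι → ℝ) →L[ℝ] E := fun x => S x ∘L (N x).inverse with hσ₀
  have hσ₀d : ContDiffOn ℝ ∞ σ₀ O₁ := by
    intro x hx
    have h1 : ContDiffAt ℝ ∞ (fun x => (N x).inverse) x :=
      ((hO₁sub x hx).1.contDiffAt_map_inverse).comp x
        (hNd.contDiffAt (hO.mem_nhds (hO₁sub x hx).2))
    exact ((hSd.contDiffAt (hO.mem_nhds (hO₁sub x hx).2)).clm_comp h1).contDiffWithinAt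
  have hPσ : ∀ x ∈ O₁, ∀ a, P (σ₀ x a) = a := by
    intro x hx a
    obtain ⟨e, he⟩ := (hO₁sub x hx).1
    have : N x ((N x).inverse a) = a := by
      rw [← he, ContinuousLinearMap.inverse_equiv]
      exact e.apply_symm_apply a
    exact this
  have hσr : ∀ x ∈ O₁, (σ₀ x).range = Submodule.span ℝ (Set.range fun i => X i x) := by
    intro x hx
    rw [← hSr]
    obtain ⟨e, he⟩ := (hO₁sub x hx).1
    ext v
    constructor
    · rintro ⟨c, rfl⟩
      exact ⟨(N x).inverse c, rfl⟩
    · rintro ⟨c, rfl⟩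
      refine ⟨N x c, ?_⟩
      change S x ((N x).inverse (N x c)) = S x c
      rw [← he, ContinuousLinearMap.inverse_equiv]
      exact congrArg (S x) (e.symm_apply_apply c)
  have hσf : ∀ x ∈ O₁, ∀ a v, fderiv ℝ (fun y => σ₀ y a) x v = fderiv ℝ σ₀ x v a := by
    intro x hx a v
    have hd := (hσ₀d.contDiffAt (hO₁.mem_nhds hx)).differentiableAt (by simp)
    have := hd.hasFDerivAt.clm_apply (hasFDerivAt_const a x)
    rw [this.fderiv]
    simp
  have hcomm₀ : ∀ x ∈ O₁, ∀ a b, fderiv ℝ σ₀ x (σ₀ x a) b = fderiv ℝ σ₀ x (σ₀ x b) a := by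
    intro x hx a b
    have hsm : ∀ a, ContDiffOn ℝ ∞ (fun y => σ₀ y a) O₁ := fun a =>
      hσ₀d.clm_apply contDiffOn_const
    have hsp : ∀ a, ∀ y ∈ O₁, σ₀ y a ∈ Submodule.span ℝ (Set.range fun i => X i y) := by
      intro a y hy
      rw [← hσr y hy]
      exact ⟨a, rfl⟩
    have hbr := hinv O₁ (fun y hy => (hO₁sub y hy).2) hO₁ _ _ (hsm a) (hsm b) (hsp a) (hsp b) x hx
    rw [← hσr x hx] at hbr
    obtain ⟨c, hc⟩ := hbr
    replace hc : σ₀ x c = fderiv ℝ (fun y => σ₀ y b) x (σ₀ x a) -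
      fderiv ℝ (fun y => σ₀ y a) x (σ₀ x b) := hc
    rw [hσf x hx, hσf x hx] at hc
    -- `P (σ₀ y a)` does not depend on `y`, so `P` kills the bracket. The bracket is also `σ₀ x c`
    -- by involutivity, and applying `P` yields `c = 0`.
    have hPf : ∀ a v, P (fderiv ℝ σ₀ x v a) = 0 := by
      intro a v
      rw [← hσf x hx]
      have hd := ((hsm a).contDiffAt (hO₁.mem_nhds hx)).differentiableAt (by simp)
      have h1 := P.hasFDerivAt.comp x hd.hasFDerivAt
      have h2 : HasFDerivAt (P ∘ fun y => σ₀ y a) (0 : E →L[ℝ] (ι → ℝ)) x := by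
        refine (hasFDerivAt_const a x).congr_of_eventuallyEq ?_
        filter_upwards [hO₁.mem_nhds hx] with y hy
        exact hPσ y hy a
      exact congrArg (fun l => l v) (h1.unique h2)
    have hc0 : c = 0 := by
      rw [← hPσ x hx c, hc, map_sub, hPf, hPf, sub_zero]
    rw [hc0, map_zero] at hc
    exact sub_eq_zero.1 hc.symm
  -- The flow construction needs a globally smooth family, whereas `σ₀` is smooth only on `O₁`.
  obtain ⟨σ, hσ, hσeq⟩ := exists_contDiff_eventuallyEq hσ₀d (hO₁.mem_nhds hpO₁)
  obtain ⟨f, hf, hfk⟩ := exists_firstIntegrals_of_commute σ hσ p (by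
    filter_upwards [hσeq.fderiv (𝕜 := ℝ), hσeq, hO₁.mem_nhds hpO₁] with y hy hy' hyO a b
    rw [hy, hy']
    exact hcomm₀ y hyO a b) P (fun a => by rw [hσeq.self_of_nhds]; exact hPσ p hpO₁ a)
  have hdim : Module.finrank ℝ P.ker = Module.finrank ℝ E - Fintype.card ι := by
    have h1 := P.toLinearMap.finrank_range_add_finrank_ker
    have h2 : P.toLinearMap.range = ⊤ :=
      LinearMap.range_eq_top.2 fun a => ⟨σ₀ p a, hPσ p hpO₁ a⟩
    rw [h2, finrank_top, Module.finrank_fintype_fun_eq_card] at h1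
    exact (Nat.sub_eq_of_eq_add' h1.symm).symm
  have := FiniteDimensional.complete ℝ P.ker
  let e : P.ker ≃L[ℝ] EuclideanSpace ℝ (Fin (Module.finrank ℝ E - Fintype.card ι)) :=
    ContinuousLinearEquiv.ofFinrankEq (by rw [hdim, finrank_euclideanSpace_fin])
  refine ⟨fun x => e (f x), hf.mono fun x hx => e.contDiff.contDiffAt.comp x hx, ?_⟩
  have hfd : ∀ᶠ x in 𝓝 p, DifferentiableAt ℝ f x :=
    hf.mono fun x hx => hx.differentiableAt (by simp)
  filter_upwards [hfk, hσeq, hO₁.mem_nhds hpO₁, hfd] with x hx hx' hxO hxd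
  rw [← hσr x hxO, ← hx', ← hx]
  have h1 : fderiv ℝ (fun x => e (f x)) x = (e : P.ker →L[ℝ] _) ∘L fderiv ℝ f x :=
    (e.hasFDerivAt.comp x hxd.hasFDerivAt).fderiv
  rw [h1]
  ext v
  exact e.map_eq_zero_iff

end VectorSpaceFrobenius

theorem mlieBracket_vectorSpace {E : Type*} [NormedAddCommGroup E] [NormedSpace ℝ E]
    (Y Z : ∀ x : E, TangentSpace 𝓘(ℝ, E) x) : mlieBracket 𝓘(ℝ, E) Y Z =
      lieBracket ℝ (E := E) Y Z := by
  rw [← mlieBracketWithin_univ, mlieBracketWithin_eq_lieBracketWithin]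
  exact lieBracketWithin_univ

/-! ### Vector fields in local coordinates and as derivations. -/

section Coordinates

variable {m : ℕ} {M : Type*} [TopologicalSpace M] [ChartedSpace (EuclideanSpace ℝ (Fin m)) M]
  [IsManifold (𝓡 m) ∞ M] {ι : Type} [Fintype ι]

variable (m) in
/-- The differential of a map into a vector space, with values in this vector space. -/
noncomputable def differential {G : Type*} [NormedAddCommGroup G] [NormedSpace ℝ G] (f : M → G)
    (z : M) : TangentSpace (𝓡 m) z →L[ℝ] G :=
  mfderiv (𝓡 m) 𝓘(ℝ, G) f z

/-- The preferred chart at a point, as local coordinates. -/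
noncomputable def LocalCoordinates.chart (z : M) : LocalCoordinates m M (Fin m) where
  toOpenPartialHomeomorph := chartAt (EuclideanSpace ℝ (Fin m)) z
  smooth := contMDiffOn_chart
  smooth_symm := contMDiffOn_chart_symm

namespace LocalCoordinates

variable (φ : LocalCoordinates m M ι)

theorem mdifferentiable :
    φ.toOpenPartialHomeomorph.MDifferentiable (𝓡 m) 𝓘(ℝ, EuclideanSpace ℝ ι) :=
  ⟨φ.smooth.mdifferentiableOn (by simp), φ.smooth_symm.mdifferentiableOn (by simp)⟩

theorem contMDiffAt {z : M} (hz : z ∈ φ.source) :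
    ContMDiffAt (𝓡 m) 𝓘(ℝ, EuclideanSpace ℝ ι) ∞ φ.toFun z :=
  φ.smooth.contMDiffAt (φ.open_source.mem_nhds hz)

theorem contMDiffAt_symm {x : EuclideanSpace ℝ ι} (hx : x ∈ φ.target) :
    ContMDiffAt 𝓘(ℝ, EuclideanSpace ℝ ι) (𝓡 m) ∞ φ.invFun x :=
  φ.smooth_symm.contMDiffAt (φ.open_target.mem_nhds hx)

theorem isInvertible_mfderiv {z : M} (hz : z ∈ φ.source) :
    (mfderiv (𝓡 m) 𝓘(ℝ, EuclideanSpace ℝ ι) φ.toFun z).IsInvertible :=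
  ⟨φ.mdifferentiable.mfderiv hz, rfl⟩

theorem isInvertible_mfderiv_symm {x : EuclideanSpace ℝ ι} (hx : x ∈ φ.target) :
    (mfderiv 𝓘(ℝ, EuclideanSpace ℝ ι) (𝓡 m) φ.invFun x).IsInvertible :=
  ⟨φ.mdifferentiable.symm.mfderiv hx, rfl⟩

/-- The differential of the inverse of the coordinate map. -/
noncomputable def dsymm (x : EuclideanSpace ℝ ι) :
    EuclideanSpace ℝ ι →L[ℝ] TangentSpace (𝓡 m) (φ.invFun x) :=
  mfderiv 𝓘(ℝ, EuclideanSpace ℝ ι) (𝓡 m) φ.invFun x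

theorem dsymm_bijective {x : EuclideanSpace ℝ ι} (hx : x ∈ φ.target) :
    Function.Bijective (φ.dsymm x) :=
  (φ.mdifferentiable.symm.mfderiv hx).bijective

theorem differential_dsymm {x : EuclideanSpace ℝ ι} (hx : x ∈ φ.target) (v) :
    differential m φ.toFun (φ.invFun x) (φ.dsymm x v) = v :=
  congrArg (fun l => l v) (φ.mdifferentiable.comp_symm_deriv hx)

theorem differential_bijective {z : M} (hz : z ∈ φ.source) :
    Function.Bijective (differential m φ.toFun z) :=
  (φ.mdifferentiable.mfderiv hz).bijective

theorem differential_comp_dsymm {G : Type*} [NormedAddCommGroup G] [NormedSpace ℝ G] {f : M → G}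
    {x : EuclideanSpace ℝ ι} (hx : x ∈ φ.target)
    (hf : MDifferentiableAt (𝓡 m) 𝓘(ℝ, G) f (φ.invFun x)) (v) :
    differential m f (φ.invFun x) (φ.dsymm x v) = fderiv ℝ (f ∘ φ.invFun) x v := by
  have h := mfderiv_comp x hf ((φ.contMDiffAt_symm hx).mdifferentiableAt (by simp))
  rw [mfderiv_eq_fderiv] at h
  exact (congrArg (fun l => l v) h).symm

/-- The vector field with a given expression in local coordinates. -/
noncomputable def pull (Y : EuclideanSpace ℝ ι → EuclideanSpace ℝ ι) (z : M) :
    TangentSpace (𝓡 m) z :=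
  mpullback (𝓡 m) 𝓘(ℝ, EuclideanSpace ℝ ι) φ.toFun Y z

theorem differential_pull (Y : EuclideanSpace ℝ ι → EuclideanSpace ℝ ι) {z : M}
    (hz : z ∈ φ.source) : differential m φ.toFun z (φ.pull Y z) = Y (φ.toFun z) := by
  obtain ⟨e, he⟩ := φ.isInvertible_mfderiv hz
  change mfderiv (𝓡 m) 𝓘(ℝ, EuclideanSpace ℝ ι) φ.toFun z
    ((mfderiv (𝓡 m) 𝓘(ℝ, EuclideanSpace ℝ ι) φ.toFun z).inverse (Y (φ.toFun z))) = _
  rw [← he, ContinuousLinearMap.inverse_equiv]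
  exact e.apply_symm_apply _

theorem pull_symm (Y : EuclideanSpace ℝ ι → EuclideanSpace ℝ ι) {x : EuclideanSpace ℝ ι}
    (hx : x ∈ φ.target) : φ.pull Y (φ.invFun x) = φ.dsymm x (Y x) := by
  have h' : φ.toFun (φ.invFun x) = x := φ.right_inv' hx
  exact (φ.differential_bijective (φ.map_target hx)).1 <|
    ((φ.differential_pull Y (φ.map_target hx)).trans (congrArg Y h')).trans
      (φ.differential_dsymm hx _).symm

theorem smoothFieldOn_pull {Y : EuclideanSpace ℝ ι → EuclideanSpace ℝ ι} {O : Set _}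
    (hO : IsOpen O) (hY : ContDiffOn ℝ ∞ Y O) {U : Set M} (hU : U ⊆ φ.source)
    (hUO : ∀ z ∈ U, φ.toFun z ∈ O) : SmoothFieldOn (φ.pull Y) U := by
  intro z hz
  have h : ContMDiffAt 𝓘(ℝ, EuclideanSpace ℝ ι) 𝓘(ℝ, EuclideanSpace ℝ ι).tangent ∞
      (fun y => (⟨y, Y y⟩ : TangentBundle 𝓘(ℝ, EuclideanSpace ℝ ι) (EuclideanSpace ℝ ι)))
      (φ.toFun z) := by
    rw [← contMDiffWithinAt_univ]
    exact contMDiffWithinAt_vectorSpace_iff_contDiffWithinAt.2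
      (hY.contDiffAt (hO.mem_nhds (hUO z hz))).contDiffWithinAt
  exact (h.mpullback_vectorField_preimage (φ.contMDiffAt (hU hz))
    (φ.isInvertible_mfderiv (hU hz)) (by simp)).contMDiffWithinAt

theorem mlieBracket_pull {Y Z : EuclideanSpace ℝ ι → EuclideanSpace ℝ ι} {x : EuclideanSpace ℝ ι}
    (hx : x ∈ φ.target) (hY : ContDiffAt ℝ ∞ Y x) (hZ : ContDiffAt ℝ ∞ Z x) :
    mlieBracket (𝓡 m) (φ.pull Y) (φ.pull Z) (φ.invFun x) =
      φ.dsymm x (lieBracket ℝ Y Z x) := by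
  have : IsManifold (𝓡 m) (minSmoothness ℝ 2) M := IsManifold.of_le (n := ∞) (by
    simpa using ENat.LEInfty.out)
  have h' : φ.toFun (φ.invFun x) = x := φ.right_inv' hx
  have key : ∀ Y : EuclideanSpace ℝ ι → EuclideanSpace ℝ ι, ContDiffAt ℝ ∞ Y x →
      MDifferentiableAt 𝓘(ℝ, EuclideanSpace ℝ ι) 𝓘(ℝ, EuclideanSpace ℝ ι).tangent
      (fun y => (⟨y, Y y⟩ : TangentBundle 𝓘(ℝ, EuclideanSpace ℝ ι) (EuclideanSpace ℝ ι)))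
      (φ.toFun (φ.invFun x)) := by
    intro Y hY
    rw [h']
    refine ContMDiffAt.mdifferentiableAt (n := ∞) ?_ (by simp)
    rw [← contMDiffWithinAt_univ]
    exact contMDiffWithinAt_vectorSpace_iff_contDiffWithinAt.2 hY.contDiffWithinAt
  have h := mpullback_mlieBracket (I := 𝓡 m) (I' := 𝓘(ℝ, EuclideanSpace ℝ ι)) (n := ∞)
    (key Y hY) (key Z hZ) (φ.contMDiffAt (φ.map_target hx)) (by simpa using ENat.LEInfty.out)
  refine h.symm.trans ?_
  refine (φ.pull_symm _ hx).trans ?_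
  exact congrArg (φ.dsymm x) (congrFun (mlieBracket_vectorSpace Y Z) x)

/-- The expression of a vector field in local coordinates. -/
noncomputable def push (X : ∀ z : M, TangentSpace (𝓡 m) z) :
    EuclideanSpace ℝ ι → EuclideanSpace ℝ ι :=
  mpullback 𝓘(ℝ, EuclideanSpace ℝ ι) (𝓡 m) φ.invFun X

theorem dsymm_push (X : ∀ z : M, TangentSpace (𝓡 m) z) {x : EuclideanSpace ℝ ι}
    (hx : x ∈ φ.target) :
    φ.dsymm x (φ.push X x) = X (φ.invFun x) := by
  obtain ⟨e, he⟩ := φ.isInvertible_mfderiv_symm hx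
  change mfderiv 𝓘(ℝ, EuclideanSpace ℝ ι) (𝓡 m) φ.invFun x
    ((mfderiv 𝓘(ℝ, EuclideanSpace ℝ ι) (𝓡 m) φ.invFun x).inverse (X (φ.invFun x))) = _
  rw [← he, ContinuousLinearMap.inverse_equiv]
  exact e.apply_symm_apply _

theorem contDiffAt_push {X : ∀ z : M, TangentSpace (𝓡 m) z} {U : Set M} (hU : IsOpen U)
    (hX : SmoothFieldOn X U) {x : EuclideanSpace ℝ ι} (hx : x ∈ φ.target) (hxU : φ.invFun x ∈ U) :
    ContDiffAt ℝ ∞ (φ.push X) x := by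
  have h : ContMDiffAt (𝓡 m) (𝓡 m).tangent ∞
      (fun z => (⟨z, X z⟩ : TangentBundle (𝓡 m) M)) (φ.invFun x) :=
    hX.contMDiffAt (hU.mem_nhds hxU)
  have h2 := h.mpullback_vectorField_preimage (φ.contMDiffAt_symm hx)
    (φ.isInvertible_mfderiv_symm hx) (by simp)
  rw [← contMDiffWithinAt_univ] at h2
  exact contDiffWithinAt_univ.1 (contMDiffWithinAt_vectorSpace_iff_contDiffWithinAt.1 h2)

theorem push_mlieBracket {X Y : ∀ z : M, TangentSpace (𝓡 m) z} {U : Set M} (hU : IsOpen U)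
    (hX : SmoothFieldOn X U) (hY : SmoothFieldOn Y U) {x : EuclideanSpace ℝ ι} (hx : x ∈ φ.target)
    (hxU : φ.invFun x ∈ U) :
    φ.push (mlieBracket (𝓡 m) X Y) x = lieBracket ℝ (φ.push X) (φ.push Y) x := by
  have : IsManifold (𝓡 m) (minSmoothness ℝ 2) M := IsManifold.of_le (n := ∞) (by
    simpa using ENat.LEInfty.out)
  have h := mpullback_mlieBracket (I := 𝓘(ℝ, EuclideanSpace ℝ ι)) (I' := 𝓡 m) (n := ∞)
    (hX.contMDiffAt (hU.mem_nhds hxU) |>.mdifferentiableAt (by simp))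
    (hY.contMDiffAt (hU.mem_nhds hxU) |>.mdifferentiableAt (by simp))
    (φ.contMDiffAt_symm hx) (by simpa using ENat.LEInfty.out)
  exact h.trans (congrFun (mlieBracket_vectorSpace _ _) x)

end LocalCoordinates


section Derivations

variable {G : Type*} [NormedAddCommGroup G] [NormedSpace ℝ G]

/-- The second-derivative terms of the two iterated derivatives cancel by symmetry. -/
theorem fderiv_lieBracket {E : Type*} [NormedAddCommGroup E] [NormedSpace ℝ E] {f : E → G}
    {X Y : E → E} {x : E} (hf : ContDiffAt ℝ ∞ f x) (hX : DifferentiableAt ℝ X x)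
    (hY : DifferentiableAt ℝ Y x) :
    fderiv ℝ f x (lieBracket ℝ X Y x) = fderiv ℝ (fun y => fderiv ℝ f y (Y y)) x (X x) -
      fderiv ℝ (fun y => fderiv ℝ f y (X y)) x (Y x) := by
  have hd : DifferentiableAt ℝ (fderiv ℝ f) x :=
    (hf.fderiv_right (m := ∞) (by simp)).differentiableAt (by simp)
  have hs := hf.isSymmSndFDerivAt (by simpa using ENat.LEInfty.out)
  have h : ∀ Y : E → E, DifferentiableAt ℝ Y x → ∀ v,
      fderiv ℝ (fun y => fderiv ℝ f y (Y y)) x v =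
        fderiv ℝ f x (fderiv ℝ Y x v) + fderiv ℝ (fderiv ℝ f) x v (Y x) := by
    intro Y hY v
    rw [(hd.hasFDerivAt.clm_apply hY.hasFDerivAt).fderiv]
    simp
  rw [h Y hY, h X hX, hs.eq (X x) (Y x)]
  simp [lieBracket_eq]

/-- The function is the fibre component of the tangent map of `f` composed with the section `X`. -/
theorem contMDiffOn_differential_apply {f : M → G} {X : ∀ z : M, TangentSpace (𝓡 m) z}
    {U : Set M} (hU : IsOpen U) (hf : ContMDiffOn (𝓡 m) 𝓘(ℝ, G) ∞ f U) (hX : SmoothFieldOn X U) :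
    ContMDiffOn (𝓡 m) 𝓘(ℝ, G) ∞ (fun z => differential m f z (X z)) U := by
  have h1 := (hf.contMDiffOn_tangentMapWithin (m := ∞) (by simp)
    (hU.uniqueMDiffOn (I := 𝓡 m))).comp hX (fun z hz => hz)
  have h0 : ContMDiff 𝓘(ℝ, G).tangent 𝓘(ℝ, G) ∞ (fun p : TangentBundle 𝓘(ℝ, G) G => p.2) :=
    contMDiff_snd_tangentBundle_modelSpace G 𝓘(ℝ, G)
  have h2 := h0.comp_contMDiffOn h1
  refine h2.congr fun z hz => ?_
  have h3 : mfderivWithin (𝓡 m) 𝓘(ℝ, G) f U z = mfderiv (𝓡 m) 𝓘(ℝ, G) f z :=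
    mfderivWithin_of_isOpen hU hz
  exact congrArg (fun l => l (X z)) h3.symm

theorem differential_congr {f g : M → G} {z : M} (h : f =ᶠ[𝓝 z] g) :
    differential m f z = differential m g z :=
  h.mfderiv_eq

theorem differential_const (c : G) (z : M) : differential m (fun _ : M => c) z = 0 :=
  mfderiv_const

theorem differential_clm_comp {G' : Type*} [NormedAddCommGroup G'] [NormedSpace ℝ G']
    (l : G →L[ℝ] G') {f : M → G} {z : M} (hf : MDifferentiableAt (𝓡 m) 𝓘(ℝ, G) f z) :
    differential m (fun z => l (f z)) z = l ∘L differential m f z := by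
  have h := mfderiv_comp z l.mdifferentiableAt hf
  rw [l.mfderiv_eq] at h
  exact h

theorem differential_prodMk {G' : Type*} [NormedAddCommGroup G'] [NormedSpace ℝ G']
    {f : M → G} {g : M → G'} {z : M} (hf : MDifferentiableAt (𝓡 m) 𝓘(ℝ, G) f z)
    (hg : MDifferentiableAt (𝓡 m) 𝓘(ℝ, G') g z) :
    differential m (fun z => (f z, g z)) z = (differential m f z).prod (differential m g z) := by
  have h := hf.prodMk_space hg
  refine ContinuousLinearMap.ext fun v => Prod.ext ?_ ?_
  · exact (congrArg (fun l => l v)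
      (differential_clm_comp (ContinuousLinearMap.fst ℝ G G') h)).symm
  · exact (congrArg (fun l => l v)
      (differential_clm_comp (ContinuousLinearMap.snd ℝ G G') h)).symm

/-- Vector fields act on functions as derivations, and the Lie bracket is the commutator. -/
theorem differential_mlieBracket {f : M → G} {X Y : ∀ z : M, TangentSpace (𝓡 m) z} {U : Set M}
    (hU : IsOpen U) (hf : ContMDiffOn (𝓡 m) 𝓘(ℝ, G) ∞ f U) (hX : SmoothFieldOn X U)
    (hY : SmoothFieldOn Y U) {z : M} (hz : z ∈ U) :
    differential m f z (mlieBracket (𝓡 m) X Y z) =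
      differential m (fun w => differential m f w (Y w)) z (X z) -
        differential m (fun w => differential m f w (X w)) z (Y z) := by
  obtain ⟨φ, hφz⟩ : ∃ φ : LocalCoordinates m M (Fin m), z ∈ φ.source :=
    ⟨LocalCoordinates.chart z, mem_chart_source _ z⟩
  obtain ⟨x, hx, rfl⟩ : ∃ x ∈ φ.target, φ.invFun x = z :=
    ⟨φ.toFun z, φ.map_source hφz, φ.left_inv' hφz⟩
  have hfz : ContMDiffAt (𝓡 m) 𝓘(ℝ, G) ∞ f (φ.invFun x) := hf.contMDiffAt (hU.mem_nhds hz)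
  have hfc : ContDiffAt ℝ ∞ (f ∘ φ.invFun) x :=
    (hfz.comp x (φ.contMDiffAt_symm hx)).contDiffAt
  have hcont : ContinuousAt φ.invFun x := (φ.contMDiffAt_symm hx).continuousAt
  have key : ∀ X : ∀ z : M, TangentSpace (𝓡 m) z, ∀ y ∈ φ.target, φ.invFun y ∈ U →
      differential m f (φ.invFun y) (X (φ.invFun y)) = fderiv ℝ (f ∘ φ.invFun) y (φ.push X y) := by
    intro X y hy hyU
    rw [← φ.dsymm_push X hy]
    exact φ.differential_comp_dsymm hy
      ((hf.contMDiffAt (hU.mem_nhds hyU)).mdifferentiableAt (by simp)) _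
  have key2 : ∀ X Y : ∀ z : M, TangentSpace (𝓡 m) z, SmoothFieldOn Y U →
      differential m (fun w => differential m f w (Y w)) (φ.invFun x) (X (φ.invFun x)) =
        fderiv ℝ (fun y => fderiv ℝ (f ∘ φ.invFun) y (φ.push Y y)) x (φ.push X x) := by
    intro X Y hY
    rw [← φ.dsymm_push X hx, φ.differential_comp_dsymm hx
      (((contMDiffOn_differential_apply hU hf hY).contMDiffAt
        (hU.mem_nhds hz)).mdifferentiableAt (by simp))]
    have : ((fun w => differential m f w (Y w)) ∘ φ.invFun) =ᶠ[𝓝 x]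
        fun y => fderiv ℝ (f ∘ φ.invFun) y (φ.push Y y) := by
      filter_upwards [φ.open_target.mem_nhds hx, hcont (hU.mem_nhds hz)] with y hy hyU
      exact key Y y hy hyU
    rw [this.fderiv_eq]
  rw [key _ x hx hz, key2 X Y hY, key2 Y X hX, φ.push_mlieBracket hU hX hY hx hz]
  exact fderiv_lieBracket hfc ((φ.contDiffAt_push hU hX hx hz).differentiableAt (by simp))
    ((φ.contDiffAt_push hU hY hx hz).differentiableAt (by simp))

end Derivations

end Coordinates

/-! ### The Frobenius theorem and the inverse function theorem on the manifold. -/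

section Frobenius

variable {m : ℕ} {M : Type*} [TopologicalSpace M] [ChartedSpace (EuclideanSpace ℝ (Fin m)) M]
  [IsManifold (𝓡 m) ∞ M] {ι κ : Type} [Fintype ι] [Fintype κ]

theorem exists_localCoordinates_mem (z : M) :
    ∃ φ : LocalCoordinates m M (Fin m), z ∈ φ.source :=
  ⟨LocalCoordinates.chart z, mem_chart_source _ z⟩

namespace LocalCoordinates

variable (φ : LocalCoordinates m M ι)

theorem exists_mem_target {z : M} (hz : z ∈ φ.source) : ∃ x ∈ φ.target, φ.invFun x = z :=
  ⟨φ.toFun z, φ.map_source hz, φ.left_inv' hz⟩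

theorem mem_span_push_iff (X : κ → ∀ z : M, TangentSpace (𝓡 m) z) {x : EuclideanSpace ℝ ι}
    (hx : x ∈ φ.target) (v : EuclideanSpace ℝ ι) :
    v ∈ Submodule.span ℝ (Set.range fun i => φ.push (X i) x) ↔
      φ.dsymm x v ∈ Submodule.span ℝ (Set.range fun i => X i (φ.invFun x)) := by
  have h : (Set.range fun i => X i (φ.invFun x)) =
      φ.dsymm x '' (Set.range fun i => φ.push (X i) x) := by
    rw [← Set.range_comp]
    exact congrArg Set.range (funext fun i => (φ.dsymm_push (X i) hx).symm)
  rw [h]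
  have h2 := Submodule.map_span (φ.dsymm x).toLinearMap (Set.range fun i => φ.push (X i) x)
  rw [ContinuousLinearMap.coe_coe] at h2
  rw [← h2]
  constructor
  · exact fun hv => ⟨v, hv, rfl⟩
  · rintro ⟨w, hw, hwv⟩
    rwa [← (φ.dsymm_bijective hx).1 hwv]

theorem linearIndependent_push_iff (X : κ → ∀ z : M, TangentSpace (𝓡 m) z)
    {x : EuclideanSpace ℝ ι} (hx : x ∈ φ.target) :
    LinearIndependent ℝ (fun i => φ.push (X i) x) ↔
      LinearIndependent ℝ (fun i => X i (φ.invFun x)) := by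
  have h : (fun i => X i (φ.invFun x)) = (φ.dsymm x).toLinearMap ∘ fun i => φ.push (X i) x :=
    funext fun i => (φ.dsymm_push (X i) hx).symm
  rw [h]
  exact ((φ.dsymm x).toLinearMap.linearIndependent_iff
    (LinearMap.ker_eq_bot.2 (φ.dsymm_bijective hx).1)).symm

end LocalCoordinates

/-- Linear independence of smooth vector fields is an open condition. -/
theorem eventually_linearIndependent {X : κ → ∀ z : M, TangentSpace (𝓡 m) z} {U : Set M}
    (hU : IsOpen U) (hX : ∀ i, SmoothFieldOn (X i) U) {z₀ : M} (hz₀ : z₀ ∈ U)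
    (hli : LinearIndependent ℝ fun i => X i z₀) :
    ∀ᶠ z in 𝓝 z₀, LinearIndependent ℝ fun i => X i z := by
  obtain ⟨φ, hφ⟩ := exists_localCoordinates_mem (m := m) z₀
  obtain ⟨x, hx, rfl⟩ := φ.exists_mem_target hφ
  have hc : ContinuousAt (fun y i => φ.push (X i) y) x :=
    continuousAt_pi.2 fun i => (φ.contDiffAt_push hU (hX i) hx hz₀).continuousAt
  have h1 : ∀ᶠ y in 𝓝 x, LinearIndependent ℝ fun i => φ.push (X i) y :=
    hc.eventually (((φ.linearIndependent_push_iff X hx).2 hli).eventually)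
  have h2 : Filter.Tendsto φ.toFun (𝓝 (φ.invFun x)) (𝓝 x) := by
    have h3 := (φ.contMDiffAt hφ).continuousAt
    have h4 : φ.toFun (φ.invFun x) = x := φ.right_inv' hx
    rw [ContinuousAt, h4] at h3
    exact h3
  filter_upwards [h2.eventually h1, φ.open_source.mem_nhds hφ] with z hz' hzs
  have hz := (φ.linearIndependent_push_iff X (φ.map_source hzs)).1 hz'
  have h5 : φ.invFun (φ.toFun z) = z := φ.left_inv' hzs
  -- The tangent space depends on the point, so the equality `h5` is used by substitution of a free
  -- variable.
  have h6 : ∀ w, w = z → LinearIndependent ℝ (fun i => X i w) →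
      LinearIndependent ℝ fun i => X i z := by
    rintro w rfl h
    exact h
  exact h6 _ h5 hz

/-- The Frobenius theorem: an involutive distribution is locally the common kernel of the
differentials of a family of functions. -/
theorem exists_firstIntegrals (D : ∀ z : M, Submodule ℝ (TangentSpace (𝓡 m) z))
    {k : ℕ} (hk : Fintype.card κ = k)
    {X : κ → ∀ z : M, TangentSpace (𝓡 m) z} {U : Set M} (hU : IsOpen U) (hX : IsFrameOn D X U)
    (hinv : IsInvolutiveOn D U) {z₀ : M} (hz₀ : z₀ ∈ U) :
    ∃ f : M → EuclideanSpace ℝ (Fin (m - k)), ∃ U' ⊆ U, IsOpen U' ∧ z₀ ∈ U' ∧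
      ContMDiffOn (𝓡 m) 𝓘(ℝ, EuclideanSpace ℝ (Fin (m - k))) ∞ f U' ∧
      ∀ z ∈ U', (differential m f z).ker = D z := by
  -- Keeping `k` apart from `Fintype.card κ` lets a frame indexed by `Fin n ⊕ Fin n` produce
  -- functions with values indexed by `Fin (m - 2 * n)`.
  subst hk
  obtain ⟨φ, hφ⟩ := exists_localCoordinates_mem (m := m) z₀
  obtain ⟨p, hp, rfl⟩ := φ.exists_mem_target hφ
  set O : Set (EuclideanSpace ℝ (Fin m)) := φ.target ∩ φ.invFun ⁻¹' U with hOdef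
  have hO : IsOpen O := φ.symm.isOpen_inter_preimage hU
  have hspan : ∀ x ∈ O, ∀ v, v ∈ Submodule.span ℝ (Set.range fun i => φ.push (X i) x) ↔
      φ.dsymm x v ∈ D (φ.invFun x) := by
    intro x hx v
    rw [φ.mem_span_push_iff X hx.1, hX.span_eq _ hx.2]
  obtain ⟨f, hf, hfk⟩ := exists_firstIntegrals_vectorSpace (d := m) (by simp) (fun i => φ.push (X i)) hO
    (p := p) ⟨hp, hz₀⟩
    (fun i x hx => (φ.contDiffAt_push hU (hX.smooth i) hx.1 hx.2).contDiffWithinAt)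
    ((φ.linearIndependent_push_iff X hp).2 (hX.linearIndependent _ hz₀)) (by
      intro O' hO'sub hO' Y Z hY hZ hYs hZs x hx
      rw [hspan x (hO'sub hx), ← φ.mlieBracket_pull (hO'sub hx).1
        (hY.contDiffAt (hO'.mem_nhds hx)) (hZ.contDiffAt (hO'.mem_nhds hx))]
      -- Involutivity is assumed for fields on `M`; fields in the chart that take values in the span
      -- are pulled back to sections of `D` in order to use it.
      have key : ∀ Y : EuclideanSpace ℝ (Fin m) → EuclideanSpace ℝ (Fin m),
          ContDiffOn ℝ ∞ Y O' →
          (∀ x ∈ O', Y x ∈ Submodule.span ℝ (Set.range fun i => φ.push (X i) x)) →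
          IsSectionOn D (φ.pull Y) (φ.source ∩ φ.toFun ⁻¹' O') := by
        intro Y hY hYs
        refine ⟨φ.smoothFieldOn_pull hO' hY Set.inter_subset_left fun z hz => hz.2, ?_⟩
        rintro z ⟨hz, hzO⟩
        obtain ⟨y, hy, rfl⟩ := φ.exists_mem_target hz
        have hyy : φ.toFun (φ.invFun y) = y := φ.right_inv' hy
        rw [Set.mem_preimage, hyy] at hzO
        rw [φ.pull_symm Y hy]
        exact (hspan y (hO'sub hzO) _).1 (hYs y hzO)
      refine hinv (φ.source ∩ φ.toFun ⁻¹' O') (φ.isOpen_inter_preimage hO') ?_ _ _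
        (key Y hY hYs) (key Z hZ hZs) _ ⟨φ.map_target (hO'sub hx).1, ?_⟩
      · rintro z ⟨hz, hzO⟩
        have hzz : φ.invFun (φ.toFun z) = z := φ.left_inv' hz
        have := (hO'sub hzO).2
        rwa [Set.mem_preimage, hzz] at this
      · have hxx : φ.toFun (φ.invFun x) = x := φ.right_inv' (hO'sub hx).1
        rwa [Set.mem_preimage, hxx])
  obtain ⟨O₂, hO₂sub, hO₂, hpO₂⟩ := eventually_nhds_iff.1
    ((hf.and hfk).and (hO.mem_nhds ⟨hp, hz₀⟩))
  have hsymm : ∀ z ∈ φ.source ∩ φ.toFun ⁻¹' O₂, ∃ x ∈ O₂, x ∈ φ.target ∧ φ.invFun x = z := by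
    rintro z ⟨hz, hzO⟩
    exact ⟨φ.toFun z, hzO, φ.map_source hz, φ.left_inv' hz⟩
  refine ⟨fun z => f (φ.toFun z), φ.source ∩ φ.toFun ⁻¹' O₂, ?_, φ.isOpen_inter_preimage hO₂,
    ⟨hφ, ?_⟩, ?_, ?_⟩
  · intro z hz
    obtain ⟨x, hxO, hx, rfl⟩ := hsymm z hz
    exact (hO₂sub x hxO).2.2
  · have hpp : φ.toFun (φ.invFun p) = p := φ.right_inv' hp
    rwa [Set.mem_preimage, hpp]
  · intro z hz
    exact ((hO₂sub _ hz.2).1.1.contMDiffAt.comp z (φ.contMDiffAt hz.1)).contMDiffWithinAt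
  · intro z hz
    have hfz : ContMDiffAt (𝓡 m) 𝓘(ℝ, EuclideanSpace ℝ (Fin (m - Fintype.card κ))) ∞
        (fun z => f (φ.toFun z)) z := (hO₂sub _ hz.2).1.1.contMDiffAt.comp z (φ.contMDiffAt hz.1)
    obtain ⟨x, hxO, hx, rfl⟩ := hsymm z hz
    have hd : ∀ v, differential m (fun z => f (φ.toFun z)) (φ.invFun x) (φ.dsymm x v) =
        fderiv ℝ f x v := by
      intro v
      rw [φ.differential_comp_dsymm hx (hfz.mdifferentiableAt (by simp))]
      have : (fun z => f (φ.toFun z)) ∘ φ.invFun =ᶠ[𝓝 x] f := by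
        filter_upwards [φ.open_target.mem_nhds hx] with y hy
        exact congrArg f (φ.right_inv' hy)
      rw [this.fderiv_eq]
    ext w
    obtain ⟨v, rfl⟩ := (φ.dsymm_bijective hx).2 w
    rw [← hspan x (hO₂sub x hxO).2 v, ← (hO₂sub x hxO).1.2]
    exact (congrArg (· = 0) (hd v)).to_iff

/-- A map with bijective differential at a point defines local coordinates around this point. -/
theorem exists_localCoordinates {f : M → EuclideanSpace ℝ ι} {U : Set M} (hU : IsOpen U)
    (hf : ContMDiffOn (𝓡 m) 𝓘(ℝ, EuclideanSpace ℝ ι) ∞ f U) {z₀ : M} (hz₀ : z₀ ∈ U)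
    (hbij : Function.Bijective (differential m f z₀)) :
    ∃ φ : LocalCoordinates m M ι, z₀ ∈ φ.source ∧ φ.source ⊆ U ∧
      ∀ z ∈ φ.source, φ.toFun z = f z := by
  obtain ⟨ψ, hψ⟩ := exists_localCoordinates_mem (m := m) z₀
  obtain ⟨p, hp, rfl⟩ := ψ.exists_mem_target hψ
  set g : EuclideanSpace ℝ (Fin m) → EuclideanSpace ℝ ι := f ∘ ψ.invFun with hg
  have hgd : ∀ x ∈ ψ.target, ψ.invFun x ∈ U → ContDiffAt ℝ ∞ g x := fun x hx hxU =>
    ((hf.contMDiffAt (hU.mem_nhds hxU)).comp x (ψ.contMDiffAt_symm hx)).contDiffAt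
  have hO : IsOpen (ψ.target ∩ ψ.invFun ⁻¹' U) := ψ.symm.isOpen_inter_preimage hU
  have hgp : ∀ v, differential m f (ψ.invFun p) (ψ.dsymm p v) = fderiv ℝ g p v := fun v =>
    ψ.differential_comp_dsymm hp ((hf.contMDiffAt (hU.mem_nhds hz₀)).mdifferentiableAt (by simp)) v
  have hgbij : Function.Bijective (fderiv ℝ g p) := by
    have : (fderiv ℝ g p : EuclideanSpace ℝ (Fin m) → EuclideanSpace ℝ ι) =
        differential m f (ψ.invFun p) ∘ ψ.dsymm p := funext fun v => (hgp v).symm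
    rw [this]
    exact hbij.comp (ψ.dsymm_bijective hp)
  let e : EuclideanSpace ℝ (Fin m) ≃L[ℝ] EuclideanSpace ℝ ι :=
    ContinuousLinearEquiv.ofBijective (fderiv ℝ g p) (LinearMap.ker_eq_bot.2 hgbij.1)
      (LinearMap.range_eq_top.2 hgbij.2)
  have he : HasFDerivAt g (e : EuclideanSpace ℝ (Fin m) →L[ℝ] EuclideanSpace ℝ ι) p :=
    ((hgd p hp hz₀).differentiableAt (by simp)).hasFDerivAt
  obtain ⟨h, hmem, hcoe, hhd, hsymm⟩ := exists_smooth_localInverse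
    (Filter.eventually_of_mem (hO.mem_nhds ⟨hp, hz₀⟩) fun x hx => hgd x hx.1 hx.2) e he
  let φ := (ψ.toOpenPartialHomeomorph.trans h).restrOpen U hU
  have hsrc : ∀ z ∈ φ.source, z ∈ ψ.source ∧ ψ.toFun z ∈ h.source ∧ z ∈ U := by
    rintro z ⟨hz, hzU⟩
    rw [OpenPartialHomeomorph.trans_source] at hz
    exact ⟨hz.1, hz.2, hzU⟩
  have hval : ∀ z ∈ φ.source, φ z = f z := by
    intro z hz
    change h (ψ.toFun z) = f z
    rw [hcoe]
    exact congrArg f (ψ.left_inv' (hsrc z hz).1)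
  refine ⟨⟨φ, ?_, ?_⟩, ?_, fun z hz => (hsrc z hz).2.2, hval⟩
  · exact (hf.mono fun z hz => (hsrc z hz).2.2).congr hval
  · intro y hy
    have hz := hsrc _ (φ.map_target hy)
    have hyt : y ∈ h.target ∧ h.symm y ∈ ψ.target := by
      have h1 := hy.1
      rw [OpenPartialHomeomorph.trans_target] at h1
      exact h1
    exact ((ψ.contMDiffAt_symm hyt.2).comp y (hsymm y hyt.1).contMDiffAt).contMDiffWithinAt
  · refine ⟨?_, hz₀⟩
    rw [OpenPartialHomeomorph.trans_source]
    refine ⟨hψ, ?_⟩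
    have hpp : ψ.toFun (ψ.invFun p) = p := ψ.right_inv' hp
    change ψ.toFun (ψ.invFun p) ∈ h.source
    rwa [hpp]

end Frobenius

/-- This selects, among linear combinations of the first integrals of $D$, the functions $x^i$ dual
to the brackets with $F$ at the base point. -/
theorem exists_clm_apply_eq_single {n : ℕ} {G : Type*} [NormedAddCommGroup G] [NormedSpace ℝ G]
    [FiniteDimensional ℝ G] {w : Fin n → G} (hw : LinearIndependent ℝ w) :
    ∃ L : G →L[ℝ] (Fin n → ℝ), ∀ i, L (w i) = Pi.single i 1 := by
  obtain ⟨L, hL⟩ := (Fintype.linearCombination ℝ w).exists_leftInverse_of_injective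
    (LinearMap.ker_eq_bot.2 (linearIndependent_iff_injective_fintypeLinearCombination.1 hw))
  refine ⟨LinearMap.toContinuousLinearMap L, fun i => ?_⟩
  have h := congrArg (fun l => l (Pi.single i 1)) hL
  simpa using h

/-! ### Frames of $D + [F, D]$ and the coordinates $(t, x, dx(F))$. -/

section AdaptedCoordinates

variable {m : ℕ} {M : Type*} [TopologicalSpace M] [ChartedSpace (EuclideanSpace ℝ (Fin m)) M]
  [IsManifold (𝓡 m) ∞ M] {κ : Type} [Fintype κ]

theorem SmoothFieldOn.mono {X : ∀ z : M, TangentSpace (𝓡 m) z} {U U' : Set M}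
    (hX : SmoothFieldOn X U) (h : U' ⊆ U) : SmoothFieldOn X U' :=
  ContMDiffOn.mono hX h

theorem SmoothFieldOn.mlieBracket {X Y : ∀ z : M, TangentSpace (𝓡 m) z} {U : Set M}
    (hU : IsOpen U) (hX : SmoothFieldOn X U) (hY : SmoothFieldOn Y U) :
    SmoothFieldOn (mlieBracket (𝓡 m) X Y) U := by
  intro z hz
  have : IsManifold (𝓡 m) (minSmoothness ℝ 2) M := IsManifold.of_le (n := ∞) (by
    simpa using ENat.LEInfty.out)
  have : IsManifold (𝓡 m) (((⊤ : ℕ∞) : WithTop ℕ∞) + 1) M := by simpa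
  exact (ContMDiffAt.mlieBracket_vectorField (m := ⊤) (n := ⊤) (hX.contMDiffAt (hU.mem_nhds hz))
    (hY.contMDiffAt (hU.mem_nhds hz)) (by simp)).contMDiffWithinAt

theorem smoothFieldOn_zero (U : Set M) :
    SmoothFieldOn (fun z => (0 : TangentSpace (𝓡 m) z)) U :=
  (Bundle.contMDiff_zeroSection ℝ (TangentSpace (𝓡 m) : M → Type _)).contMDiffOn

theorem IsInvolutiveOn.mono {D : ∀ z : M, Submodule ℝ (TangentSpace (𝓡 m) z)} {A B : Set M}
    (h : IsInvolutiveOn D B) (hAB : A ⊆ B) : IsInvolutiveOn D A :=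
  fun U hU hUA => h U hU (hUA.trans hAB)

theorem IsFrameOn.isSectionOn {D : ∀ z : M, Submodule ℝ (TangentSpace (𝓡 m) z)}
    {X : κ → ∀ z : M, TangentSpace (𝓡 m) z} {U : Set M} (hX : IsFrameOn D X U) (i : κ) :
    IsSectionOn D (X i) U :=
  ⟨hX.smooth i, fun z hz => by
    rw [← hX.span_eq z hz]
    exact Submodule.subset_span ⟨i, rfl⟩⟩

theorem IsFrameOn.mono {D : ∀ z : M, Submodule ℝ (TangentSpace (𝓡 m) z)}
    {X : κ → ∀ z : M, TangentSpace (𝓡 m) z} {U U' : Set M} (hX : IsFrameOn D X U) (h : U' ⊆ U) :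
    IsFrameOn D X U' :=
  ⟨fun i => (hX.smooth i).mono h, fun z hz => hX.linearIndependent z (h hz),
    fun z hz => hX.span_eq z (h hz)⟩

theorem mlieBracket_mem_addBracket {F V : ∀ z : M, TangentSpace (𝓡 m) z}
    {D : ∀ z : M, Submodule ℝ (TangentSpace (𝓡 m) z)} {U : Set M} (hU : IsOpen U)
    (hV : IsSectionOn D V U) {z : M} (hz : z ∈ U) :
    mlieBracket (𝓡 m) F V z ∈ addBracket F D z :=
  Submodule.subset_span ⟨U, hU, hz, fun _ => 0, V,
    ⟨smoothFieldOn_zero U, fun _ _ => Submodule.zero_mem _⟩, hV, (zero_add _).symm⟩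

theorem mem_addBracket {F V : ∀ z : M, TangentSpace (𝓡 m) z}
    {D : ∀ z : M, Submodule ℝ (TangentSpace (𝓡 m) z)} {U : Set M} (hU : IsOpen U)
    (hV : IsSectionOn D V U) {z : M} (hz : z ∈ U) : V z ∈ addBracket F D z :=
  Submodule.subset_span ⟨U, hU, hz, V, fun _ => 0, hV,
    ⟨smoothFieldOn_zero U, fun _ _ => Submodule.zero_mem _⟩, by
      have h : mlieBracket (𝓡 m) F (fun z => (0 : TangentSpace (𝓡 m) z)) = 0 :=
        mlieBracket_zero_right
      rw [h]
      exact (add_zero _).symm⟩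

section

variable {G : Type*} [NormedAddCommGroup G] [NormedSpace ℝ G]

/-- The bracket of a field with a field in the kernel of `dq`, modulo this kernel. -/
theorem differential_mlieBracket_of_ker {q : M → G} {F V : ∀ z : M, TangentSpace (𝓡 m) z}
    {U : Set M} (hU : IsOpen U) (hq : ContMDiffOn (𝓡 m) 𝓘(ℝ, G) ∞ q U) (hF : SmoothFieldOn F U)
    (hV : SmoothFieldOn V U) {c : G} (hVq : ∀ z ∈ U, differential m q z (V z) = c) {z : M}
    (hz : z ∈ U) :
    differential m q z (mlieBracket (𝓡 m) F V z) =
      -differential m (fun w => differential m q w (F w)) z (V z) := by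
  rw [differential_mlieBracket hU hq hF hV hz]
  -- Only constancy of `dq(V)` matters, since its derivative along `F` then vanishes. A nonzero `c`
  -- occurs for the coordinate fields and for the brackets `W j`.
  have h : (fun w => differential m q w (V w)) =ᶠ[𝓝 z] fun _ => c :=
    Filter.eventually_of_mem (hU.mem_nhds hz) hVq
  rw [differential_congr h, differential_const]
  simp

/-- Over the domain of a frame and of first integrals, `𝒱 + [F, 𝒱]` is spanned by the frame and
its brackets with `F`. -/
theorem addBracket_eq_span {D : ∀ z : M, Submodule ℝ (TangentSpace (𝓡 m) z)}
    {F : ∀ z : M, TangentSpace (𝓡 m) z} (hF : SmoothFieldOn F Set.univ)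
    {X : κ → ∀ z : M, TangentSpace (𝓡 m) z} {U : Set M} (hU : IsOpen U) (hX : IsFrameOn D X U)
    {q : M → G} (hq : ContMDiffOn (𝓡 m) 𝓘(ℝ, G) ∞ q U)
    (hqk : ∀ z ∈ U, (differential m q z).ker = D z) {z : M} (hz : z ∈ U) :
    Submodule.span ℝ (Set.range fun j : κ ⊕ κ =>
      Sum.elim X (fun i => mlieBracket (𝓡 m) F (X i)) j z) = addBracket F D z := by
  set T := Submodule.span ℝ (Set.range fun j : κ ⊕ κ =>
      Sum.elim X (fun i => mlieBracket (𝓡 m) F (X i)) j z) with hT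
  have hXT : ∀ i, X i z ∈ T := fun i => Submodule.subset_span ⟨Sum.inl i, rfl⟩
  have hWT : ∀ i, mlieBracket (𝓡 m) F (X i) z ∈ T := fun i =>
    Submodule.subset_span ⟨Sum.inr i, rfl⟩
  have hDT : D z ≤ T := by
    rw [← hX.span_eq z hz, Submodule.span_le]
    rintro _ ⟨i, rfl⟩
    exact hXT i
  refine le_antisymm (Submodule.span_le.2 ?_) (Submodule.span_le.2 ?_)
  · rintro _ ⟨j, rfl⟩
    cases j with
    | inl i => exact mem_addBracket hU (hX.isSectionOn i) hz
    | inr i => exact mlieBracket_mem_addBracket hU (hX.isSectionOn i) hz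
  · rintro _ ⟨U', hU', hz', V₁, V₂, hV₁, hV₂, rfl⟩
    refine T.add_mem (hDT (hV₁.mem z hz')) ?_
    have hbr : ∀ V : ∀ z : M, TangentSpace (𝓡 m) z, ∀ U', IsOpen U' → z ∈ U' →
        IsSectionOn D V U' → differential m q z (mlieBracket (𝓡 m) F V z) =
        -differential m (fun w => differential m q w (F w)) z (V z) := by
      intro V U' hU' hz' hV
      refine differential_mlieBracket_of_ker (hU.inter hU') (hq.mono Set.inter_subset_left)
        (hF.mono (Set.subset_univ _)) (hV.smooth.mono Set.inter_subset_right) (c := 0) ?_ ⟨hz, hz'⟩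
      intro w hw
      have := hV.mem w hw.2
      rw [← hqk w hw.1] at this
      exact this
    obtain ⟨c, hc⟩ := (Submodule.mem_span_range_iff_exists_fun ℝ).1
      ((hX.span_eq z hz).symm ▸ hV₂.mem z hz')
    -- By `hbr`, `dq` of the bracket of `F` with a section depends linearly on the value of the
    -- section at `z`. So the coefficients of `V₂` at that single point suffice, and no coefficient
    -- functions are differentiated.
    have hmem : mlieBracket (𝓡 m) F V₂ z - ∑ i, c i • mlieBracket (𝓡 m) F (X i) z ∈ D z := by
      rw [← hqk z hz, LinearMap.mem_ker, ContinuousLinearMap.coe_coe, map_sub, map_sum,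
        hbr V₂ U' hU' hz' hV₂, ← hc, map_sum]
      simp only [map_smul, hbr _ U hU hz (hX.isSectionOn _), smul_neg, Finset.sum_neg_distrib,
        sub_self]
    have := T.add_mem (hDT hmem) (T.sum_mem (t := Finset.univ) fun i _ => T.smul_mem (c i) (hWT i))
    rwa [sub_add_cancel] at this

end

/-- The frame of `𝒱 + [F, 𝒱]` around a point of the regular set. -/
theorem exists_frame_addBracket {n : ℕ} {D : ∀ z : M, Submodule ℝ (TangentSpace (𝓡 m) z)}
    {F : ∀ z : M, TangentSpace (𝓡 m) z} (hF : SmoothFieldOn F Set.univ)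
    {X : Fin n → ∀ z : M, TangentSpace (𝓡 m) z} {U : Set M} (hU : IsOpen U)
    (hX : IsFrameOn D X U) {G : Type*} [NormedAddCommGroup G] [NormedSpace ℝ G]
    {q : M → G} (hq : ContMDiffOn (𝓡 m) 𝓘(ℝ, G) ∞ q U)
    (hqk : ∀ z ∈ U, (differential m q z).ker = D z) {z₀ : M} (hz₀ : z₀ ∈ U)
    (hreg : z₀ ∈ regularSet n F D) :
    ∃ U' ⊆ U, IsOpen U' ∧ z₀ ∈ U' ∧ U' ⊆ regularSet n F D ∧
      IsFrameOn (addBracket F D) (Sum.elim X fun i => mlieBracket (𝓡 m) F (X i)) U' := by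
  have hsm : ∀ j, SmoothFieldOn (Sum.elim X (fun i => mlieBracket (𝓡 m) F (X i)) j) U := by
    rintro (i | i)
    · exact hX.smooth i
    · exact SmoothFieldOn.mlieBracket hU (hF.mono (Set.subset_univ _)) (hX.smooth i)
  have hspan := fun z (hz : z ∈ U) => addBracket_eq_span hF hU hX hq hqk hz
  have hli : LinearIndependent ℝ fun j : Fin n ⊕ Fin n =>
      Sum.elim X (fun i => mlieBracket (𝓡 m) F (X i)) j z₀ := by
    -- At a regular point these `2 * n` fields span a space of dimension `2 * n`. Independence then
    -- persists nearby, which also shows that nearby points are regular.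
    rw [linearIndependent_iff_card_eq_finrank_span, Set.finrank, hspan z₀ hz₀]
    have : Module.finrank ℝ (addBracket F D z₀) = 2 * n := hreg
    rw [this]
    simp [two_mul]
  obtain ⟨U', hU'sub, hU', hz₀'⟩ := eventually_nhds_iff.1
    ((eventually_linearIndependent hU hsm hz₀ hli).and (hU.mem_nhds hz₀))
  refine ⟨U', fun z hz => (hU'sub z hz).2, hU', hz₀', fun z hz => ?_,
    fun j => (hsm j).mono fun z hz => (hU'sub z hz).2, fun z hz => (hU'sub z hz).1,
    fun z hz => hspan z (hU'sub z hz).2⟩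
  have h := linearIndependent_iff_card_eq_finrank_span.1 (hU'sub z hz).1
  rw [Set.finrank, hspan z (hU'sub z hz).2] at h
  change Module.finrank ℝ (addBracket F D z) = 2 * n
  rw [← h]
  simp [two_mul]

variable (m) in
/-- The splitting of the coordinate space into the coordinates `t`, `x` and `y`. -/
noncomputable def coordSplit (n : ℕ) :
    (EuclideanSpace ℝ (Fin (m - 2 * n)) × (Fin n → ℝ) × (Fin n → ℝ)) ≃L[ℝ]
      EuclideanSpace ℝ (CoordIndex m n) :=
  LinearEquiv.toContinuousLinearEquiv
    { toFun := fun p => WithLp.toLp 2 (Sum.elim p.1.ofLp (Sum.elim p.2.1 p.2.2))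
      map_add' := fun p p' => by ext (i | i | i) <;> rfl
      map_smul' := fun c p => by ext (i | i | i) <;> rfl
      invFun := fun v => (WithLp.toLp 2 fun i => v (Sum.inl i), fun i => v (xIndex m i),
        fun i => v (yIndex m i))
      left_inv := fun p => rfl
      right_inv := fun v => by ext (i | i | i) <;> rfl }

theorem coordSplit_symm_x {n : ℕ} (i : Fin n) :
    (coordSplit m n).symm (EuclideanSpace.single (xIndex m i) 1) = (0, Pi.single i 1, 0) := by
  refine Prod.ext ?_ (Prod.ext ?_ ?_)
  · ext j
    change EuclideanSpace.single (xIndex m i) (1 : ℝ) (Sum.inl j) = 0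
    simp
  · ext j
    change EuclideanSpace.single (xIndex m i) (1 : ℝ) (xIndex m j) = _
    simp [Pi.single_apply]
  · ext j
    change EuclideanSpace.single (xIndex m i) (1 : ℝ) (yIndex m j) = 0
    simp

theorem coordSplit_symm_y {n : ℕ} (i : Fin n) :
    (coordSplit m n).symm (EuclideanSpace.single (yIndex m i) 1) = (0, 0, Pi.single i 1) := by
  refine Prod.ext ?_ (Prod.ext ?_ ?_)
  · ext j
    change EuclideanSpace.single (yIndex m i) (1 : ℝ) (Sum.inl j) = 0
    simp
  · ext j
    change EuclideanSpace.single (yIndex m i) (1 : ℝ) (xIndex m j) = 0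
    simp
  · ext j
    change EuclideanSpace.single (yIndex m i) (1 : ℝ) (yIndex m j) = _
    simp [Pi.single_apply]

theorem LocalCoordinates.smoothFieldOn_coordField {ι : Type} [Fintype ι] [DecidableEq ι]
    (φ : LocalCoordinates m M ι) (j : ι) : SmoothFieldOn (φ.coordField j) φ.source :=
  φ.smoothFieldOn_pull isOpen_univ (Y := fun _ => EuclideanSpace.single j (1 : ℝ))
    contDiffOn_const subset_rfl fun _ _ => Set.mem_univ _

theorem LocalCoordinates.differential_coordField {ι : Type} [Fintype ι] [DecidableEq ι]
    (φ : LocalCoordinates m M ι) (j : ι) {z : M} (hz : z ∈ φ.source) :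
    differential m φ.toFun z (φ.coordField j z) = EuclideanSpace.single j 1 :=
  φ.differential_pull (fun _ => EuclideanSpace.single j (1 : ℝ)) hz

/-- The differential of the coordinate map is constant on coordinate fields, so it kills their
bracket, and it is injective. -/
theorem LocalCoordinates.mlieBracket_coordField {ι : Type} [Fintype ι] [DecidableEq ι]
    (φ : LocalCoordinates m M ι) (j k : ι) {z : M} (hz : z ∈ φ.source) :
    mlieBracket (𝓡 m) (φ.coordField j) (φ.coordField k) z = 0 := by
  refine (φ.differential_bijective hz).1 ?_
  rw [map_zero, differential_mlieBracket_of_ker φ.open_source φ.smooth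
    (φ.smoothFieldOn_coordField j) (φ.smoothFieldOn_coordField k)
    (fun z hz => φ.differential_coordField k hz) hz]
  have h : (fun w => differential m φ.toFun w (φ.coordField j w)) =ᶠ[𝓝 z]
      fun _ => EuclideanSpace.single j 1 :=
    Filter.eventually_of_mem (φ.open_source.mem_nhds hz) fun w hw => φ.differential_coordField j hw
  rw [differential_congr h, differential_const]
  simp

/-- First integrals of `𝒱` and of `𝒱 + [F, 𝒱]` around a point of the regular set, with a basis of
`𝒱`. -/
theorem exists_adapted_firstIntegrals {n : ℕ}
    {D : ∀ z : M, Submodule ℝ (TangentSpace (𝓡 m) z)}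
    (hD : IsDistribution n D) (hDinv : IsInvolutiveOn D Set.univ)
    {F : ∀ z : M, TangentSpace (𝓡 m) z} (hF : SmoothFieldOn F Set.univ)
    (hWinv : IsInvolutiveOn (addBracket F D) (regularSet n F D))
    {z₀ : M} (hz₀ : z₀ ∈ regularSet n F D) :
    ∃ (U : Set M) (X : Fin n → ∀ z : M, TangentSpace (𝓡 m) z)
      (q : M → EuclideanSpace ℝ (Fin (m - n))) (t : M → EuclideanSpace ℝ (Fin (m - 2 * n))),
      IsOpen U ∧ z₀ ∈ U ∧ IsFrameOn D X U ∧
      IsFrameOn (addBracket F D) (Sum.elim X fun i => mlieBracket (𝓡 m) F (X i)) U ∧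
      ContMDiffOn (𝓡 m) 𝓘(ℝ, EuclideanSpace ℝ (Fin (m - n))) ∞ q U ∧
      (∀ z ∈ U, (differential m q z).ker = D z) ∧
      ContMDiffOn (𝓡 m) 𝓘(ℝ, EuclideanSpace ℝ (Fin (m - 2 * n))) ∞ t U ∧
      ∀ z ∈ U, (differential m t z).ker = addBracket F D z := by
  obtain ⟨U₀, hU₀, hzU₀, X, hX⟩ := hD z₀
  obtain ⟨q, U₁, hU₁₀, hU₁, hzU₁, hq, hqk⟩ := exists_firstIntegrals D (k := n) (by simp) hU₀ hX
    (hDinv.mono (Set.subset_univ _)) hzU₀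
  obtain ⟨U₂, hU₂₁, hU₂, hzU₂, hreg, hW⟩ := exists_frame_addBracket hF hU₁ (hX.mono hU₁₀) hq hqk
    hzU₁ hz₀
  obtain ⟨t, U₃, hU₃₂, hU₃, hzU₃, ht, htk⟩ := exists_firstIntegrals (addBracket F D) (k := 2 * n)
    (by simp [two_mul]) hU₂ hW (hWinv.mono hreg) hzU₂
  exact ⟨U₃, X, q, t, hU₃, hzU₃, hX.mono ((hU₃₂.trans hU₂₁).trans hU₁₀), hW.mono hU₃₂,
    hq.mono (hU₃₂.trans hU₂₁), fun z hz => hqk z (hU₂₁ (hU₃₂ hz)), ht, htk⟩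

/-- Injectivity suffices because the dimensions agree: `(m - 2 * n) + n + n = m`, where `hmn` makes
the truncated subtraction exact. -/
theorem bijective_differential_coordSplit {n : ℕ} (hmn : 2 * n ≤ m) {z : M}
    {l : TangentSpace (𝓡 m) z →L[ℝ]
      EuclideanSpace ℝ (Fin (m - 2 * n)) × (Fin n → ℝ) × (Fin n → ℝ)}
    (hl : ∀ v, l v = 0 → v = 0) :
    Function.Bijective ((coordSplit m n).toContinuousLinearMap ∘L l) := by
  have hinj : Function.Injective ((coordSplit m n).toContinuousLinearMap ∘L l) := by
    refine (injective_iff_map_eq_zero _).2 fun v hv => hl v ?_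
    exact (coordSplit m n).injective (hv.trans (map_zero _).symm)
  refine ⟨hinj, ?_⟩
  have : FiniteDimensional ℝ (TangentSpace (𝓡 m) z) :=
    inferInstanceAs (FiniteDimensional ℝ (EuclideanSpace ℝ (Fin m)))
  have hd : Module.finrank ℝ (TangentSpace (𝓡 m) z) = m :=
    finrank_euclideanSpace_fin (𝕜 := ℝ) (n := m)
  refine (LinearMap.injective_iff_surjective_of_finrank_eq_finrank (f :=
    ((coordSplit m n).toContinuousLinearMap ∘L l).toLinearMap) ?_).1 hinj
  rw [hd, finrank_euclideanSpace]
  simp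
  omega

/-- The coordinate functions `(t, x, y)` with `y = dx(F)`. -/
noncomputable def adaptedMap {n : ℕ} (F : ∀ z : M, TangentSpace (𝓡 m) z)
    (t : M → EuclideanSpace ℝ (Fin (m - 2 * n))) (x : M → Fin n → ℝ) (z : M) :
    EuclideanSpace ℝ (CoordIndex m n) :=
  coordSplit m n (t z, x z, differential m x z (F z))

section

variable {n : ℕ} {F : ∀ z : M, TangentSpace (𝓡 m) z} {U : Set M}
  {t : M → EuclideanSpace ℝ (Fin (m - 2 * n))} {x : M → Fin n → ℝ}

theorem contMDiffOn_adaptedMap (hU : IsOpen U) (hF : SmoothFieldOn F U)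
    (ht : ContMDiffOn (𝓡 m) 𝓘(ℝ, EuclideanSpace ℝ (Fin (m - 2 * n))) ∞ t U)
    (hx : ContMDiffOn (𝓡 m) 𝓘(ℝ, Fin n → ℝ) ∞ x U) :
    ContMDiffOn (𝓡 m) 𝓘(ℝ, EuclideanSpace ℝ (CoordIndex m n)) ∞ (adaptedMap F t x) U :=
  (coordSplit m n).contDiff.contMDiff.comp_contMDiffOn
    (ht.prodMk_space (hx.prodMk_space (contMDiffOn_differential_apply hU hx hF)))

theorem differential_adaptedMap (hU : IsOpen U) (hF : SmoothFieldOn F U)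
    (ht : ContMDiffOn (𝓡 m) 𝓘(ℝ, EuclideanSpace ℝ (Fin (m - 2 * n))) ∞ t U)
    (hx : ContMDiffOn (𝓡 m) 𝓘(ℝ, Fin n → ℝ) ∞ x U) {z : M} (hz : z ∈ U) :
    differential m (adaptedMap F t x) z = (coordSplit m n).toContinuousLinearMap ∘L
      (differential m t z).prod ((differential m x z).prod
        (differential m (fun w => differential m x w (F w)) z)) := by
  have ht' := (ht.contMDiffAt (hU.mem_nhds hz)).mdifferentiableAt (by simp)
  have hx' := (hx.contMDiffAt (hU.mem_nhds hz)).mdifferentiableAt (by simp)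
  have hy' := ((contMDiffOn_differential_apply hU hx hF).contMDiffAt
    (hU.mem_nhds hz)).mdifferentiableAt (by simp)
  rw [← differential_prodMk hx' hy', ← differential_prodMk ht' (hx'.prodMk_space hy')]
  exact differential_clm_comp (coordSplit m n).toContinuousLinearMap
    (ht'.prodMk_space (hx'.prodMk_space hy'))

/-- The differentials of the adapted coordinates determine tangent vectors. -/
theorem eq_zero_of_adapted (hU : IsOpen U) (hF : SmoothFieldOn F U)
    (hx : ContMDiffOn (𝓡 m) 𝓘(ℝ, Fin n → ℝ) ∞ x U)
    {X : Fin n → ∀ z : M, TangentSpace (𝓡 m) z} (hX : ∀ i, SmoothFieldOn (X i) U)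
    (hXx : ∀ i, ∀ z ∈ U, differential m x z (X i z) = 0) {z : M} (hz : z ∈ U)
    (hxW : ∀ i, differential m x z (mlieBracket (𝓡 m) F (X i) z) = -Pi.single i 1)
    {v : TangentSpace (𝓡 m) z}
    (hv : v ∈ Submodule.span ℝ (Set.range fun j : Fin n ⊕ Fin n =>
      Sum.elim X (fun i => mlieBracket (𝓡 m) F (X i)) j z))
    (hv₁ : differential m x z v = 0)
    (hv₂ : differential m (fun w => differential m x w (F w)) z v = 0) : v = 0 := by
  obtain ⟨c, rfl⟩ := (Submodule.mem_span_range_iff_exists_fun ℝ).1 hv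
  -- The system is triangular: `dx` kills the `X i` and reads off the coefficients of the brackets,
  -- after which `dy` reads off those of the `X i`.
  have hy : ∀ i, differential m (fun w => differential m x w (F w)) z (X i z) =
      Pi.single i 1 := fun i => by
    rw [← neg_inj, ← hxW i]
    exact (differential_mlieBracket_of_ker hU hx hF (hX i) (hXx i) hz).symm
  have hb : ∀ i, c (Sum.inr i) = 0 := fun i => by
    have h := congrFun hv₁ i
    simpa [Fintype.sum_sum_type, hXx _ z hz, hxW, Pi.single_apply] using h
  have ha : ∀ i, c (Sum.inl i) = 0 := fun i => by
    have h := congrFun hv₂ i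
    simpa [Fintype.sum_sum_type, hb, hy, Pi.single_apply] using h
  simp [Fintype.sum_sum_type, ha, hb]

end

/-- Adapted coordinates `(t, x, y)` around a point of the regular set. -/
theorem exists_adaptedCoordinates {n : ℕ} (hmn : 2 * n ≤ m)
    {D : ∀ z : M, Submodule ℝ (TangentSpace (𝓡 m) z)}
    (hD : IsDistribution n D) (hDinv : IsInvolutiveOn D Set.univ)
    {F : ∀ z : M, TangentSpace (𝓡 m) z} (hF : SmoothFieldOn F Set.univ)
    (hWinv : IsInvolutiveOn (addBracket F D) (regularSet n F D))
    {z₀ : M} (hz₀ : z₀ ∈ regularSet n F D) :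
    ∃ (φ : LocalCoordinates m M (CoordIndex m n))
      (t : M → EuclideanSpace ℝ (Fin (m - 2 * n))) (x : M → Fin n → ℝ),
      z₀ ∈ φ.source ∧
      ContMDiffOn (𝓡 m) 𝓘(ℝ, EuclideanSpace ℝ (Fin (m - 2 * n))) ∞ t φ.source ∧
      ContMDiffOn (𝓡 m) 𝓘(ℝ, Fin n → ℝ) ∞ x φ.source ∧
      (∀ z ∈ φ.source, φ.toFun z = adaptedMap F t x z) ∧
      (∀ z ∈ φ.source, (differential m t z).ker = addBracket F D z) ∧
      ∀ z ∈ φ.source, D z ≤ addBracket F D z ∧ D z ≤ (differential m x z).ker ∧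
        Module.finrank ℝ (D z) = n := by
  obtain ⟨U, X, q, t, hU, hzU, hX, hW, hq, hqk, ht, htk⟩ :=
    exists_adapted_firstIntegrals hD hDinv hF hWinv hz₀
  have hFU : SmoothFieldOn F U := hF.mono (Set.subset_univ _)
  have hXq : ∀ i, ∀ z ∈ U, differential m q z (X i z) = 0 := fun i z hz => by
    have h := (hX.isSectionOn i).mem z hz
    rwa [← hqk z hz] at h
  -- A relation among these vectors would put a combination of the brackets into `D z₀`, against
  -- independence of the frame of $D + [F,D]$. The minus sign makes `dy (X i)` equal to `+e i`.
  have hli : LinearIndependent ℝ fun i =>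
      -differential m q z₀ (mlieBracket (𝓡 m) F (X i) z₀) := by
    refine Fintype.linearIndependent_iff.2 fun c hc => ?_
    have hmem : ∑ i, c i • mlieBracket (𝓡 m) F (X i) z₀ ∈ D z₀ := by
      rw [← hqk z₀ hzU, LinearMap.mem_ker, ContinuousLinearMap.coe_coe, map_sum, ← neg_eq_zero]
      simpa using hc
    obtain ⟨a, ha⟩ := (Submodule.mem_span_range_iff_exists_fun ℝ).1
      ((hX.span_eq z₀ hzU).symm ▸ hmem)
    have h := Fintype.linearIndependent_iff.1 (hW.linearIndependent z₀ hzU) (Sum.elim a (-c))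
      (by simp [Fintype.sum_sum_type, ha])
    intro i
    simpa using h (Sum.inr i)
  obtain ⟨L, hL⟩ := exists_clm_apply_eq_single hli
  -- As a function of `q`, `x` is constant along `D` throughout `U`; the normalisation of `dx` on
  -- the brackets holds only at `z₀`, which is enough for the inverse function theorem.
  set x : M → Fin n → ℝ := fun z => L (q z) with hx_def
  have hx : ContMDiffOn (𝓡 m) 𝓘(ℝ, Fin n → ℝ) ∞ x U :=
    L.contDiff.contMDiff.comp_contMDiffOn hq
  have hdx : ∀ z ∈ U, differential m x z = L ∘L differential m q z := fun z hz =>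
    differential_clm_comp L ((hq.contMDiffAt (hU.mem_nhds hz)).mdifferentiableAt (by simp))
  have hXx : ∀ i, ∀ z ∈ U, differential m x z (X i z) = 0 := fun i z hz => by
    rw [hdx z hz, ContinuousLinearMap.comp_apply, hXq i z hz, map_zero]
  have hxW : ∀ i, differential m x z₀ (mlieBracket (𝓡 m) F (X i) z₀) = -Pi.single i 1 :=
    fun i => by
      rw [hdx z₀ hzU, ContinuousLinearMap.comp_apply, ← hL i, map_neg, neg_neg]
  have hbij : Function.Bijective (differential m (adaptedMap F t x) z₀) := by
    rw [differential_adaptedMap hU hFU ht hx hzU]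
    refine bijective_differential_coordSplit hmn fun v hv => ?_
    have hv₀ : v ∈ (differential m t z₀).ker := congrArg Prod.fst hv
    rw [htk z₀ hzU, ← hW.span_eq z₀ hzU] at hv₀
    exact eq_zero_of_adapted hU hFU hx hX.smooth hXx hzU hxW hv₀
      (congrArg (fun p => p.2.1) hv) (congrArg (fun p => p.2.2) hv)
  obtain ⟨φ, hφz, hφU, hφ⟩ := exists_localCoordinates hU (contMDiffOn_adaptedMap hU hFU ht hx) hzU
    hbij
  refine ⟨φ, t, x, hφz, ht.mono hφU, hx.mono hφU, hφ, fun z hz => htk z (hφU hz),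
    fun z hz => ⟨?_, ?_, ?_⟩⟩
  · rw [← hX.span_eq z (hφU hz), Submodule.span_le]
    rintro _ ⟨i, rfl⟩
    exact mem_addBracket hU (hX.isSectionOn i) (hφU hz)
  · intro v hv
    rw [← hqk z (hφU hz)] at hv
    have hv' : differential m q z v = 0 := hv
    change differential m x z v = 0
    rw [hdx z (hφU hz), ContinuousLinearMap.comp_apply, hv', map_zero]
  · rw [← hX.span_eq z (hφU hz), finrank_span_eq_card (hX.linearIndependent z (hφU hz)),
      Fintype.card_fin]

section

variable {n : ℕ} {F : ∀ z : M, TangentSpace (𝓡 m) z}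
  {t : M → EuclideanSpace ℝ (Fin (m - 2 * n))} {x : M → Fin n → ℝ}
  {φ : LocalCoordinates m M (CoordIndex m n)}

theorem differential_eq_coordSplit (hF : SmoothFieldOn F Set.univ)
    (ht : ContMDiffOn (𝓡 m) 𝓘(ℝ, EuclideanSpace ℝ (Fin (m - 2 * n))) ∞ t φ.source)
    (hx : ContMDiffOn (𝓡 m) 𝓘(ℝ, Fin n → ℝ) ∞ x φ.source)
    (hφ : ∀ z ∈ φ.source, φ.toFun z = adaptedMap F t x z) {z : M} (hz : z ∈ φ.source)
    (v : TangentSpace (𝓡 m) z) :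
    differential m φ.toFun z v = coordSplit m n (differential m t z v, differential m x z v,
      differential m (fun w => differential m x w (F w)) z v) := by
  rw [differential_congr (Filter.eventually_of_mem (φ.open_source.mem_nhds hz) hφ),
    differential_adaptedMap φ.open_source (hF.mono (Set.subset_univ _)) ht hx hz]
  rfl

theorem differential_adapted_coordField_x (hF : SmoothFieldOn F Set.univ)
    (ht : ContMDiffOn (𝓡 m) 𝓘(ℝ, EuclideanSpace ℝ (Fin (m - 2 * n))) ∞ t φ.source)
    (hx : ContMDiffOn (𝓡 m) 𝓘(ℝ, Fin n → ℝ) ∞ x φ.source)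
    (hφ : ∀ z ∈ φ.source, φ.toFun z = adaptedMap F t x z) {z : M} (hz : z ∈ φ.source)
    (i : Fin n) :
    differential m t z (φ.coordField (xIndex m i) z) = 0 ∧
      differential m x z (φ.coordField (xIndex m i) z) = Pi.single i 1 := by
  have h := differential_eq_coordSplit hF ht hx hφ hz (φ.coordField (xIndex m i) z)
  rw [φ.differential_coordField _ hz, ← ContinuousLinearEquiv.symm_apply_eq,
    coordSplit_symm_x] at h
  exact ⟨(congrArg Prod.fst h).symm, (congrArg (fun p => p.2.1) h).symm⟩

theorem differential_adapted_coordField_y (hF : SmoothFieldOn F Set.univ)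
    (ht : ContMDiffOn (𝓡 m) 𝓘(ℝ, EuclideanSpace ℝ (Fin (m - 2 * n))) ∞ t φ.source)
    (hx : ContMDiffOn (𝓡 m) 𝓘(ℝ, Fin n → ℝ) ∞ x φ.source)
    (hφ : ∀ z ∈ φ.source, φ.toFun z = adaptedMap F t x z) {z : M} (hz : z ∈ φ.source)
    (i : Fin n) :
    differential m t z (φ.coordField (yIndex m i) z) = 0 ∧
      differential m x z (φ.coordField (yIndex m i) z) = 0 ∧
      differential m (fun w => differential m x w (F w)) z (φ.coordField (yIndex m i) z) =
        Pi.single i 1 := by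
  have h := differential_eq_coordSplit hF ht hx hφ hz (φ.coordField (yIndex m i) z)
  rw [φ.differential_coordField _ hz, ← ContinuousLinearEquiv.symm_apply_eq,
    coordSplit_symm_y] at h
  exact ⟨(congrArg Prod.fst h).symm, (congrArg (fun p => p.2.1) h).symm,
    (congrArg (fun p => p.2.2) h).symm⟩

/-- The common kernel of `dt` and `dx` is spanned by the coordinate fields `∂/∂yⁱ`. -/
theorem mem_span_coordField_y (hF : SmoothFieldOn F Set.univ)
    (ht : ContMDiffOn (𝓡 m) 𝓘(ℝ, EuclideanSpace ℝ (Fin (m - 2 * n))) ∞ t φ.source)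
    (hx : ContMDiffOn (𝓡 m) 𝓘(ℝ, Fin n → ℝ) ∞ x φ.source)
    (hφ : ∀ z ∈ φ.source, φ.toFun z = adaptedMap F t x z) {z : M} (hz : z ∈ φ.source)
    {v : TangentSpace (𝓡 m) z} (hvt : differential m t z v = 0)
    (hvx : differential m x z v = 0) :
    v ∈ Submodule.span ℝ (Set.range fun i : Fin n => φ.coordField (yIndex m i) z) := by
  refine (Submodule.mem_span_range_iff_exists_fun ℝ).2
    -- The coefficients of `v` are its `y`-components, that is, `dy(v)`.
    ⟨differential m (fun w => differential m x w (F w)) z v, ?_⟩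
  refine (φ.differential_bijective hz).1 ?_
  have hy := fun i => differential_adapted_coordField_y hF ht hx hφ hz i
  rw [differential_eq_coordSplit hF ht hx hφ hz, differential_eq_coordSplit hF ht hx hφ hz v,
    hvt, hvx]
  simp only [map_sum, map_smul, (hy _).1, (hy _).2.1, (hy _).2.2, smul_zero,
    Finset.sum_const_zero]
  congr 3
  ext j
  simp [Finset.sum_apply, Pi.single_apply]

end

theorem LocalCoordinates.linearIndependent_coordField {ι : Type} [Fintype ι] [DecidableEq ι]
    (φ : LocalCoordinates m M ι) {z : M} (hz : z ∈ φ.source) :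
    LinearIndependent ℝ fun j => φ.coordField j z := by
  refine LinearIndependent.of_comp (differential m φ.toFun z).toLinearMap ?_
  have h : (differential m φ.toFun z).toLinearMap ∘ (fun j => φ.coordField j z) =
      EuclideanSpace.basisFun ι ℝ := by
    ext1 j
    simpa using φ.differential_coordField j hz
  rw [h]
  exact (EuclideanSpace.basisFun ι ℝ).orthonormal.linearIndependent

end AdaptedCoordinates

end SecondOrderType

/-! ### The adapted frame formed by the fields $\partial/\partial y^i$. -/

open SecondOrderType in
theorem mainTheorem9 {m n : ℕ} (hmn : 2 * n ≤ m)
    {M : Type*} [TopologicalSpace M] [ChartedSpace (EuclideanSpace ℝ (Fin m)) M]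
    [IsManifold (𝓡 m) ∞ M]
    (D : ∀ z : M, Submodule ℝ (TangentSpace (𝓡 m) z))
    (hD : IsDistribution n D) (hDinv : IsInvolutiveOn D Set.univ)
    (F : ∀ z : M, TangentSpace (𝓡 m) z) (hF : SmoothFieldOn F Set.univ)
    (hWinv : IsInvolutiveOn (addBracket F D) (regularSet n F D))
    (z₀ : M) (hz₀ : z₀ ∈ regularSet n F D) :
    ∃ (φ : LocalCoordinates m M (CoordIndex m n))
      (V : Fin n → ∀ z : M, TangentSpace (𝓡 m) z),
      z₀ ∈ φ.source ∧ IsAdaptedFrameOn F D V φ.source ∧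
      ∀ i : Fin n, ∀ z ∈ φ.source,
        V i z = φ.coordField (yIndex m i) z ∧
        mlieBracket (𝓡 m) F (V i) z - (-φ.coordField (xIndex m i) z) ∈ D z := by
  obtain ⟨φ, t, x, hφz, ht, hx, hφ, htk, hD'⟩ :=
    exists_adaptedCoordinates hmn hD hDinv hF hWinv hz₀
  have hxf := fun z (hz : z ∈ φ.source) i => differential_adapted_coordField_x hF ht hx hφ hz i
  have hyf := fun z (hz : z ∈ φ.source) i => differential_adapted_coordField_y hF ht hx hφ hz i
  have hli : ∀ z ∈ φ.source, LinearIndependent ℝ fun i : Fin n => φ.coordField (yIndex m i) z :=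
    fun z hz => (φ.linearIndependent_coordField hz).comp _
      (Sum.inr_injective.comp Sum.inr_injective)
  have hspan : ∀ z ∈ φ.source,
      Submodule.span ℝ (Set.range fun i : Fin n => φ.coordField (yIndex m i) z) = D z := by
    intro z hz
    have : FiniteDimensional ℝ (TangentSpace (𝓡 m) z) :=
      inferInstanceAs (FiniteDimensional ℝ (EuclideanSpace ℝ (Fin m)))
    -- `D z` is contained in the common kernel of `dt` and `dx`, hence in the span of the `n` fields
    -- `∂/∂yⁱ`; the dimensions agree.
    refine (Submodule.eq_of_le_of_finrank_eq (fun v hv => ?_) ?_).symm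
    · refine mem_span_coordField_y hF ht hx hφ hz ?_ ((hD' z hz).2.1 hv)
      have h := (hD' z hz).1 hv
      rwa [← htk z hz] at h
    · rw [(hD' z hz).2.2, finrank_span_eq_card (hli z hz), Fintype.card_fin]
  have hmem : ∀ z ∈ φ.source, ∀ v : TangentSpace (𝓡 m) z, differential m t z v = 0 →
      differential m x z v = 0 → v ∈ D z := fun z hz v hvt hvx =>
    hspan z hz ▸ mem_span_coordField_y hF ht hx hφ hz hvt hvx
  have hframe : IsFrameOn D (fun i : Fin n => φ.coordField (yIndex m i)) φ.source :=
    ⟨fun i => φ.smoothFieldOn_coordField _, hli, hspan⟩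
  have hFφ : SmoothFieldOn F φ.source := hF.mono (Set.subset_univ _)
  have hWt : ∀ i, ∀ z ∈ φ.source, differential m t z
      (mlieBracket (𝓡 m) F (φ.coordField (yIndex m i)) z) = 0 := by
    intro i z hz
    have h := mlieBracket_mem_addBracket (F := F) φ.open_source (hframe.isSectionOn i) hz
    rwa [← htk z hz] at h
  -- Since `y = dx(F)` is itself a coordinate, $dx([F,\partial_{y^i}]) = -\partial_{y^i}y = -e_i$ on
  -- the whole domain, although the original frame was normalised only at `z₀`.
  have hWx : ∀ i, ∀ z ∈ φ.source, differential m x z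
      (mlieBracket (𝓡 m) F (φ.coordField (yIndex m i)) z) = -Pi.single i 1 := by
    intro i z hz
    rw [differential_mlieBracket_of_ker φ.open_source hx hFφ (hframe.smooth i)
      (fun w hw => (hyf w hw i).2.1) hz, (hyf z hz i).2.2]
  refine ⟨φ, fun i => φ.coordField (yIndex m i), hφz, ⟨hframe, fun i j z hz =>
    φ.mlieBracket_coordField _ _ hz, fun i j z hz => ?_⟩, fun i z hz => ⟨rfl, ?_⟩⟩
  -- Both `dt` and `dx` are constant on `V i` and on `W j`, so both kill their bracket, which
  -- therefore lies in `D`.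
  · have hW := SmoothFieldOn.mlieBracket φ.open_source hFφ (hframe.smooth j)
    refine hmem z hz _ ?_ ?_
    · rw [differential_mlieBracket_of_ker φ.open_source ht (hframe.smooth i) hW (hWt j) hz,
        differential_congr (Filter.eventually_of_mem (φ.open_source.mem_nhds hz)
          fun w hw => (hyf w hw i).1), differential_const]
      simp
    · rw [differential_mlieBracket_of_ker φ.open_source hx (hframe.smooth i) hW (hWx j) hz,
        differential_congr (Filter.eventually_of_mem (φ.open_source.mem_nhds hz)
          fun w hw => (hyf w hw i).2.1), differential_const]
      simp
  · refine hmem z hz _ ?_ ?_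
    · rw [sub_neg_eq_add, map_add, hWt i z hz, (hxf z hz i).1, add_zero]
    · rw [sub_neg_eq_add, map_add, hWx i z hz, (hxf z hz i).2, neg_add_cancel]
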